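/- **Setting.** Let $N=\mathbb{R}[L_1,L_2,L_3]$ be the algebra of real polynomials on $\mathbb{R}^3\cong\mathfrak{su}(2)^*$, and let $\varepsilon_{ijk}$ be the totally skew-symmetric tensor with $\varepsilon_{123}=1$. On polynomials on $\mathbb{R}^6$ (coordinates $p_1,p_2,p_3,q_1,q_2,q_3$) consider the Moyal product $f\ast_M g=\exp(\nu\mathcal P)(f,g)=\sum_{r\ge 0}\frac{\nu^r}{r!}\mathcal P^r(f,g)$, where $\mathcal P=\sum_{k=1}^3(\partial_{p_k}\otimes\partial_{q_k}-\partial_{q_k}\otimes\partial_{p_k})$. Put $L_i(p,q)=\sum_{j,k}\varepsilon_{ijk}p_jq_k$. The map $F\mapsto F(L_1(p,q),L_2(p,q),L_3(p,q))$ embeds $N$ into the polynomials on $\mathbb{R}^6$. Let $\ast$ be the induced star product on $\mathbb{R}^3$, extended $\nu$-linearly to $N[[\nu]]$. Let $\mathcal S$ be the symmetric tensor algebra over $N$. Let $\alpha$ be the linear map that annihilates the positive powers of $\nu$ and sends a monomial $L_{i_1}\cdots L_{i_k}\in N$ to the symmetric tensor $L_{i_1}\otimes\cdots\otimes L_{i_k}\in\mathcal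 S$. Let $T$ be the linear map on $\mathcal S$ given by $T(F_1\otimes\cdots\otimes F_k)=\frac1{k!}\sum_{\sigma\in S_k}F_{\sigma_1}\ast\cdots\ast F_{\sigma_k}$ (and $T(1)=1$). The sun product associated with $\ast$ is $F\odot_\nu G=T(\alpha(F)\otimes\alpha(G))$. Let $\mathcal D=\sum_k L_k\,\partial/\partial L_k$ and $\Delta=\sum_k\partial^2/\partial L_k^2$. Let $\gamma_n=E_{2n}/(2n)!$ and $\tau_n=2^{2n+2}(2^{2n+2}-1)B_{2n+2}/(2n+2)!$, where $E_{2n}$ and $B_{2n+2}$ are the Euler and Bernoulli numbers, all taken positive ($\sec x=\sum_n E_{2n}x^{2n}/(2n)!$, so $E_2=1$, $E_4=5$; $B_2=\frac16$, $B_4=\frac1{30}$). Let $A_k=\sum_{i+j=k,\ i,j\ge0}\gamma_i\gamma_j$ and $$z_{p,r}=\sum_{k=p}^{r}A_{r-k}\sum_{(n_1,\dots,n_p)}\frac{\tau_{n_1}\cdots\tau_{n_p}}{m_1!\cdots m_r!},$$ where the inner sum is over the partitions $k=n_1+\cdots+n_p$, $n_1\ge\cdots\ge n_p\ge1$, of $k$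 of length $p$, and $m_i$ is the number of parts equal to $i$. For $r\ge1$ put $$\eta_r=\Bigl(A_r+\sum_{p=1}^{r}z_{p,r}\,\mathcal D(\mathcal D-1)\cdots(\mathcal D-p+1)\Bigr)\Delta^r .$$ **Theorem.** The star product $\ast$ is well defined: for all $F,G\in N$, $F(L(p,q))\ast_M G(L(p,q))$ is the pullback to $\mathbb{R}^6$ of a formal series $F\ast G\in N[[\nu]]$. Moreover, for $F\in N$ and $i=1,2,3$, $$L_i\ast F=L_iF+\nu\sum_{j,k}\varepsilon_{ijk}L_k\frac{\partial F}{\partial L_j}+\nu^2\Bigl(2\frac{\partial F}{\partial L_i}+\sum_jL_j\frac{\partial^2F}{\partial L_i\partial L_j}\Bigr).$$ The sun product associated with $\ast$ satisfies $$F\odot_\nu G=FG+\sum_{r\ge1}\nu^{2r}\,\eta_r(FG)\qquad\text{for all } F,G\in N .$$ It has a unique extension to a map $C^\infty(\mathbb{R}^3)\times C^\infty(\mathbb{R}^3)\to C^\infty(\mathbb{R}^3)[[\nu]]$ whose coefficient at each power of $\nu$ is a bidifferential operator with smooth coefficients, and this extension is given by the same formula, for all $F,G\in C^\infty(\mathbb{R}^3)$.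 -/

import Mathlib

open scoped ContDiff TensorProduct PowerSeries

namespace SunProduct

noncomputable section

/-! ### Polynomials on `ℝ³` and on `ℝ⁶` -/

/-- Real polynomials on `ℝ³ ≅ su(2)^*`, with coordinates `L₁, L₂, L₃` (indexed from `0`). -/
abbrev N : Type := MvPolynomial (Fin 3) ℝ

/-- Real polynomials on `ℝ⁶`: `Sum.inl i` is the index of `p_i`, `Sum.inr i` that of `q_i`. -/
abbrev N6 : Type := MvPolynomial (Fin 3 ⊕ Fin 3) ℝ

/-- The totally skew-symmetric tensor with `ε₁₂₃ = 1` (the indices run over `0, 1, 2` here). -/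
def eps (i j k : Fin 3) : ℝ :=
  (((j : ℝ) - (i : ℝ)) * ((k : ℝ) - (j : ℝ)) * ((k : ℝ) - (i : ℝ))) / 2

/-- `L_i(p,q) = ∑_{j,k} ε_{ijk} p_j q_k`. -/
def Lfun (i : Fin 3) : N6 :=
  ∑ j, ∑ k, MvPolynomial.C (eps i j k) *
    (MvPolynomial.X (Sum.inl j) * MvPolynomial.X (Sum.inr k))

/-- The pullback `F ↦ F(L₁(p,q), L₂(p,q), L₃(p,q))`. -/
def pullback : N →ₐ[ℝ] N6 := MvPolynomial.aeval Lfun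

/-! ### The Moyal product on `ℝ⁶` -/

/-- The Poisson bidifferential operator `∑_k (∂_{p_k} ⊗ ∂_{q_k} - ∂_{q_k} ⊗ ∂_{p_k})`. -/
def poissonOp : Module.End ℝ (N6 ⊗[ℝ] N6) :=
  ∑ k : Fin 3,
    (TensorProduct.map
        (MvPolynomial.pderiv (R := ℝ) (Sum.inl k : Fin 3 ⊕ Fin 3)).toLinearMap
        (MvPolynomial.pderiv (R := ℝ) (Sum.inr k : Fin 3 ⊕ Fin 3)).toLinearMap
      - TensorProduct.map
        (MvPolynomial.pderiv (R := ℝ) (Sum.inr k : Fin 3 ⊕ Fin 3)).toLinearMap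
        (MvPolynomial.pderiv (R := ℝ) (Sum.inl k : Fin 3 ⊕ Fin 3)).toLinearMap)

/-- The `r`-th cochain `(1/r!) P^r (f, g)` of the Moyal product `exp(ν P)(f, g)`. -/
def moyalC (r : ℕ) : N6 →ₗ[ℝ] N6 →ₗ[ℝ] N6 :=
  (TensorProduct.mk ℝ N6 N6).compr₂
    (LinearMap.mul' ℝ N6 ∘ₗ ((r.factorial : ℝ)⁻¹ • poissonOp ^ r))

/-- The Moyal product `f ∗_M g = ∑_r ν^r (1/r!) P^r (f, g)` of two polynomials on `ℝ⁶`. -/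
def moyal (f g : N6) : N6⟦X⟧ := PowerSeries.mk fun r => moyalC r f g

/-! ### The induced star product on `ℝ³` -/

lemma eval_Lfun (v : Fin 3 ⊕ Fin 3 → ℝ) (i : Fin 3) :
    MvPolynomial.eval v (Lfun i) = ∑ j, ∑ k, eps i j k * (v (Sum.inl j) * v (Sum.inr k)) := by
  simp [Lfun]

/-- The functions `L₁, L₂, L₃` are algebraically independent. -/
lemma pullback_injective : Function.Injective pullback := by
  rw [injective_iff_map_eq_zero]
  intro F hF
  have h : F * MvPolynomial.X 2 = 0 := by
    apply MvPolynomial.funext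
    intro x
    by_cases hx : x 2 = 0
    · simp [hx]
    · let v : Fin 3 ⊕ Fin 3 → ℝ :=
        Sum.elim ![x 2, 0, -x 0] ![0, 1, -x 1 / x 2]
      have hv : (fun i => MvPolynomial.eval v (Lfun i)) = x := by
        funext i
        rw [eval_Lfun]
        fin_cases i <;> simp [Fin.sum_univ_three, eps, v] <;> field_simp <;> norm_num
      have h0 : MvPolynomial.eval v (pullback F) = 0 := by rw [hF]; simp
      have h1 : MvPolynomial.eval v (pullback F) = MvPolynomial.eval x F := by
        clear hF h0
        have hv' : ∀ i, MvPolynomial.eval v (Lfun i) = x i := fun i => congrFun hv i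
        induction F using MvPolynomial.induction_on <;> simp_all [pullback]
      rw [map_mul, ← h1, h0]; simp
  rcases mul_eq_zero.1 h with h | h
  · exact h
  · exact absurd h (MvPolynomial.X_ne_zero _)

/-- A linear left inverse of the (injective) pullback: it recovers `F` from `F(L₁, L₂, L₃)`. -/
def pullbackInv : N6 →ₗ[ℝ] N := pullback.toLinearMap.leftInverse

lemma pullbackInv_pullback (F : N) : pullbackInv (pullback F) = F :=
  LinearMap.leftInverse_apply_of_inj (f := pullback.toLinearMap)
    (LinearMap.ker_eq_bot.2 pullback_injective) F

/-- The `r`-th cochain `C_r(F, G)` of the star product on `ℝ³`: the polynomial on `ℝ³` whose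
pullback is the `r`-th Moyal cochain of the pullbacks of `F` and `G`. -/
def starC (r : ℕ) : N →ₗ[ℝ] N →ₗ[ℝ] N :=
  ((moyalC r).compl₁₂ pullback.toLinearMap pullback.toLinearMap).compr₂ pullbackInv

/-- The star product on `ℝ³`, extended `ν`-linearly to `N[[ν]]`:
`(∑_j ν^j F_j) ∗ (∑_k ν^k G_k) = ∑_{r,j,k} ν^{r+j+k} C_r(F_j, G_k)`. -/
def starProd : N⟦X⟧ →ₗ[ℝ] N⟦X⟧ →ₗ[ℝ] N⟦X⟧ :=
  LinearMap.mk₂ ℝ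
    (fun F G => PowerSeries.mk fun n =>
      ∑ a ∈ Finset.HasAntidiagonal.antidiagonal n, ∑ b ∈ Finset.HasAntidiagonal.antidiagonal a.2,
        starC a.1 (PowerSeries.coeff b.1 F) (PowerSeries.coeff b.2 G))
    (fun F F' G => by ext n : 1; simp [Finset.sum_add_distrib])
    (fun c F G => by ext n : 1; simp [Finset.smul_sum])
    (fun F G G' => by ext n : 1; simp [Finset.sum_add_distrib])
    (fun c F G => by ext n : 1; simp [Finset.smul_sum])

/-! ### The sun product -/

/-- Left star multiplication by an element of `N`. -/
def leftStar : N →ₗ[ℝ] Module.End ℝ N⟦X⟧ where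
  toFun F := starProd (PowerSeries.C F)
  map_add' F G := by simp
  map_smul' c F := by
    rw [← map_smul]; congr 1; ext n : 1
    simp only [PowerSeries.coeff_C, RingHom.id_apply, PowerSeries.coeff_smul]; split_ifs <;> simp

/-- The iterated star product `F₁ ∗ (F₂ ∗ (⋯ ∗ (F_k ∗ 1)))`. -/
def iteratedStar {k : ℕ} (F : Fin k → N) : N⟦X⟧ :=
  (List.ofFn F).foldr (fun G H => starProd (PowerSeries.C G) H) 1

/-- The symmetrized star product `(1/k!) ∑_{σ ∈ S_k} F_{σ 1} ∗ ⋯ ∗ F_{σ k}`. -/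
def symStar {k : ℕ} (F : Fin k → N) : N⟦X⟧ :=
  (k.factorial : ℝ)⁻¹ • ∑ σ : Equiv.Perm (Fin k), iteratedStar (F ∘ σ)

/-- The symmetric tensor algebra over `N`. -/
abbrev S : Type := SymmetricAlgebra ℝ N

/-- A tuple of exponents of monomials, listed with the given multiplicities (in some order). -/
def tupleOf (s : (Fin 3 →₀ ℕ) →₀ ℕ) : Fin s.toMultiset.toList.length → (Fin 3 →₀ ℕ) :=
  s.toMultiset.toList.get

/-- The evaluation map `T : S → N[[ν]]`. It is the linear map that sends every symmetric tensor
`F₁ ⊗ ⋯ ⊗ F_k` to the symmetrized star product of `F₁, …, F_k` (see `T_prod` below); it is built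
by prescribing these values on the symmetric tensors of monomials, which form a basis of `S`. -/
def T : S →ₗ[ℝ] N⟦X⟧ :=
  (MvPolynomial.basisMonomials (Fin 3) ℝ).symmetricAlgebra.constr ℝ fun s =>
    symStar fun i => MvPolynomial.basisMonomials (Fin 3) ℝ (tupleOf s i)

lemma iteratedStar_eq {k : ℕ} (F : Fin k → N) :
    iteratedStar F = (List.ofFn fun i => leftStar (F i)).prod 1 := by
  have h : ∀ l : List N, l.foldr (fun G H => starProd (PowerSeries.C G) H) 1
      = (l.map leftStar).prod 1 := by
    intro l
    induction l with
    | nil => simp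
    | cons a l ih => simp [ih, leftStar]
  rw [iteratedStar, h, List.map_ofFn]; rfl

lemma symStar_comp {k : ℕ} (F : Fin k → N) (e : Equiv.Perm (Fin k)) :
    symStar (F ∘ e) = symStar F := by
  unfold symStar
  congr 1
  exact Fintype.sum_equiv (Equiv.mulLeft e) _ _ (fun σ => rfl)

lemma symStar_congr {κ : Type*} [DecidableEq κ] (b : κ → N) {k m : ℕ} (v : Fin k → κ)
    (w : Fin m → κ)
    (h : ∑ i, Finsupp.single (v i) 1 = ∑ i, Finsupp.single (w i) (1 : ℕ)) :
    symStar (fun i => b (v i)) = symStar (fun i => b (w i)) := by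
  have hc : ∀ c, Fintype.card {i // v i = c} = Fintype.card {i // w i = c} := by
    intro c
    have := DFunLike.congr_fun h c
    simpa [Finsupp.single_apply, Fintype.card_subtype, Finsupp.finsetSum_apply,
      Finset.sum_boole] using this
  let e : Fin k ≃ Fin m := Equiv.ofFiberEquiv (f := v) (g := w) fun c => Fintype.equivOfCardEq (hc c)
  have he : ∀ i, w (e i) = v i := fun i => Equiv.ofFiberEquiv_map _ i
  obtain rfl : k = m := by simpa using Fintype.card_congr e
  rw [← symStar_comp (fun i => b (w i)) e]
  congr 1
  funext i
  simp [he]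

lemma sum_tupleOf (s : (Fin 3 →₀ ℕ) →₀ ℕ) : ∑ i, Finsupp.single (tupleOf s i) (1 : ℕ) = s := by
  have h1 : ∑ i, Finsupp.single (tupleOf s i) (1 : ℕ)
      = (s.toMultiset.toList.map fun a => Finsupp.single a (1 : ℕ)).sum := by
    rw [← List.sum_ofFn]
    congr 1
    apply List.ext_get <;> simp [tupleOf]
  rw [h1, ← Multiset.sum_coe, ← Multiset.map_coe, Multiset.coe_toList]
  conv_rhs => rw [← Finsupp.toMultiset_toFinsupp s]
  induction s.toMultiset using Multiset.induction_on with
  | empty => simp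
  | cons a t ih => simp [ih, ← Multiset.singleton_add]

/-- The defining property of the evaluation map. -/
lemma T_prod {k : ℕ} (F : Fin k → N) :
    T (∏ i, SymmetricAlgebra.ι ℝ N (F i)) =
      (k.factorial : ℝ)⁻¹ • ∑ σ : Equiv.Perm (Fin k), iteratedStar (F ∘ σ) := by
  let f : MultilinearMap ℝ (fun _ : Fin k => N) N⟦X⟧ :=
    T.compMultilinearMap ((MultilinearMap.mkPiAlgebra ℝ (Fin k) S).compLinearMap
      fun _ => SymmetricAlgebra.ι ℝ N)
  let g0 : MultilinearMap ℝ (fun _ : Fin k => N) N⟦X⟧ :=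
    (LinearMap.applyₗ (R := ℝ) (1 : N⟦X⟧)).compMultilinearMap
      ((MultilinearMap.mkPiAlgebraFin ℝ k (Module.End ℝ N⟦X⟧)).compLinearMap fun _ => leftStar)
  let g : MultilinearMap ℝ (fun _ : Fin k => N) N⟦X⟧ :=
    (k.factorial : ℝ)⁻¹ • ∑ σ : Equiv.Perm (Fin k), g0.domDomCongr σ
  have hg : ∀ F, g F = symStar F := by
    intro F
    simp only [g, symStar, smul_apply, sum_apply,
      MultilinearMap.domDomCongr_apply, iteratedStar_eq]
    rfl
  have hfg : f = g := by
    apply Module.Basis.ext_multilinear (fun _ => MvPolynomial.basisMonomials (Fin 3) ℝ)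
    intro v
    rw [hg]
    have h2 : (∏ i, SymmetricAlgebra.ι ℝ N (MvPolynomial.basisMonomials (Fin 3) ℝ (v i)))
        = (MvPolynomial.basisMonomials (Fin 3) ℝ).symmetricAlgebra
            (∑ i, Finsupp.single (v i) 1) := by
      simp only [Module.Basis.symmetricAlgebra, Module.Basis.map_apply,
        MvPolynomial.coe_basisMonomials, AlgEquiv.toLinearEquiv_apply]
      rw [eq_comm, AlgEquiv.symm_apply_eq, map_prod, MvPolynomial.monomial_sum_one]
      refine Finset.prod_congr rfl fun i _ => ?_
      have := SymmetricAlgebra.equivMvPolynomial_ι_apply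
        (MvPolynomial.basisMonomials (Fin 3) ℝ) (v i)
      rw [MvPolynomial.coe_basisMonomials] at this
      rw [this]; rfl
    have h3 : f (fun i => MvPolynomial.basisMonomials (Fin 3) ℝ (v i))
        = T (∏ i, SymmetricAlgebra.ι ℝ N (MvPolynomial.basisMonomials (Fin 3) ℝ (v i))) := rfl
    rw [h3, h2, T, Module.Basis.constr_basis]
    exact symStar_congr _ _ _ (sum_tupleOf _)
  have := DFunLike.congr_fun hfg F
  rw [hg] at this
  exact this

/-- The map `α`: it keeps the `ν⁰`-part only, and replaces the product of the coordinates in each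
monomial by the symmetric tensor product. -/
def alpha (F : N⟦X⟧) : S :=
  MvPolynomial.aeval (fun i => SymmetricAlgebra.ι ℝ N (MvPolynomial.X i))
    (PowerSeries.constantCoeff F)

/-- The sun product `F ⊙_ν G = T(α(F) ⊗ α(G))`. -/
def sun (F G : N⟦X⟧) : N⟦X⟧ := T (alpha F * alpha G)

/-! ### The coefficients -/

/-- The Euler (secant) numbers, in the convention `sec x = ∑ E_{2n} x^{2n} / (2n)!`,
so `E₀ = 1, E₂ = 1, E₄ = 5, …`. -/
def eulerNumber (n : ℕ) : ℝ := n.factorial * PowerSeries.coeff n (PowerSeries.cos ℝ)⁻¹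

/-- `γ_n = E_{2n} / (2n)!`. -/
def gam (n : ℕ) : ℝ := eulerNumber (2 * n) / (2 * n).factorial

/-- `τ_n = 2^{2n+2} (2^{2n+2} - 1) |B_{2n+2}| / (2n+2)!`, with the Bernoulli numbers taken positive
(`1/6, 1/30, 1/42, …`). -/
def tau (n : ℕ) : ℝ :=
  2 ^ (2 * n + 2) * (2 ^ (2 * n + 2) - 1) * |(bernoulli (2 * n + 2) : ℝ)| / (2 * n + 2).factorial

/-- `A_k = ∑_{i+j=k} γ_i γ_j`. -/
def coefA (k : ℕ) : ℝ := ∑ ij ∈ Finset.HasAntidiagonal.antidiagonal k, gam ij.1 * gam ij.2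

/-- `z_{p,r} = ∑_{k=p}^r A_{r-k} ∑ (m₁! ⋯ m_r!)⁻¹ τ_{n₁} ⋯ τ_{n_p}`, the inner sum being over the
partitions `k = n₁ + ⋯ + n_p` of length `p`, and `m_i` the multiplicity of `i` in the partition. -/
def coefZ (p r : ℕ) : ℝ :=
  ∑ k ∈ Finset.Icc p r, coefA (r - k) *
    ∑ n ∈ (Finset.univ : Finset k.Partition).filter (fun n => n.parts.card = p),
      (∏ i ∈ Finset.Icc 1 r, ((n.parts.count i).factorial : ℝ))⁻¹ * (n.parts.map tau).prod

/-! ### The operators `η_r`, on any algebra with coordinates and partial derivatives -/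

section Operators

variable {A : Type*} [CommRing A] [Algebra ℝ A]

/-- The Euler operator `D = ∑_k x_k ∂_k`. -/
def eulerOp (x : Fin 3 → A) (d : Fin 3 → Module.End ℝ A) : Module.End ℝ A :=
  ∑ k, LinearMap.mulLeft ℝ (x k) * d k

/-- The Laplacian `Δ = ∑_k ∂_k²`. -/
def laplacian (d : Fin 3 → Module.End ℝ A) : Module.End ℝ A := ∑ k, d k ^ 2

/-- `D (D - 1) ⋯ (D - p + 1)`. -/
def fallingOp (D : Module.End ℝ A) (p : ℕ) : Module.End ℝ A :=
  ((List.range p).map fun i => D - (i : ℝ) • 1).prod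

/-- `η_r = (A_r + ∑_{p=1}^r z_{p,r} D (D - 1) ⋯ (D - p + 1)) Δ^r`. -/
def etaOp (x : Fin 3 → A) (d : Fin 3 → Module.End ℝ A) (r : ℕ) : Module.End ℝ A :=
  (coefA r • 1 + ∑ p ∈ Finset.Icc 1 r, coefZ p r • fallingOp (eulerOp x d) p) * laplacian d ^ r

/-- The formal series `∑_{r ≥ 1} ν^{2r} u_r`. -/
def evenSeries (u : ℕ → A) : A⟦X⟧ :=
  PowerSeries.mk fun n => if n ≠ 0 ∧ Even n then u (n / 2) else 0

end Operators

/-- The partial derivatives on polynomials. -/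
def polyD (i : Fin 3) : Module.End ℝ N := (MvPolynomial.pderiv i).toLinearMap

/-- `η_r` on polynomials on `ℝ³`. -/
def eta (r : ℕ) : Module.End ℝ N := etaOp MvPolynomial.X polyD r

/-! ### Smooth functions on `ℝ³` -/

/-- The algebra `C^∞(ℝ³)` of smooth real functions. -/
def smoothSubalgebra : Subalgebra ℝ ((Fin 3 → ℝ) → ℝ) where
  carrier := {f | ContDiff ℝ ∞ f}
  mul_mem' {f g} hf hg := by
    change ContDiff ℝ ∞ f at hf
    change ContDiff ℝ ∞ g at hg
    exact hf.mul hg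
  add_mem' {f g} hf hg := by
    change ContDiff ℝ ∞ f at hf
    change ContDiff ℝ ∞ g at hg
    exact hf.add hg
  algebraMap_mem' c := by
    change ContDiff ℝ ∞ fun _ : Fin 3 → ℝ => c
    exact contDiff_const

/-- `C^∞(ℝ³)`. -/
abbrev Smooth : Type := smoothSubalgebra

lemma contDiff_smooth (f : Smooth) : ContDiff ℝ ∞ f.1 := f.2

lemma differentiable_smooth (f : Smooth) : Differentiable ℝ f.1 :=
  (contDiff_smooth f).differentiable (by simp)

/-- The partial derivative `∂_i` on `C^∞(ℝ³)`. -/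
def smoothD (i : Fin 3) : Module.End ℝ Smooth where
  toFun f := ⟨fun x => fderiv ℝ f.1 x (Pi.single i 1),
    by
      change ContDiff ℝ ∞ fun x => fderiv ℝ f.1 x (Pi.single i 1)
      exact ((contDiff_smooth f).fderiv_right (m := ∞) (by simp)).clm_apply contDiff_const⟩
  map_add' f g := by
    ext x
    change fderiv ℝ (f.1 + g.1) x _ = fderiv ℝ f.1 x _ + fderiv ℝ g.1 x _
    rw [fderiv_add (differentiable_smooth f x) (differentiable_smooth g x)]; rfl
  map_smul' c f := by
    ext x
    change fderiv ℝ (c • f.1) x _ = c • fderiv ℝ f.1 x _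
    rw [fderiv_const_smul (differentiable_smooth f x)]; rfl

/-- The coordinate functions as elements of `C^∞(ℝ³)`. -/
def smoothCoord (i : Fin 3) : Smooth := ⟨fun x => x i, by
  change ContDiff ℝ ∞ fun x : Fin 3 → ℝ => x i
  exact contDiff_apply ℝ ℝ i⟩

/-- A polynomial regarded as an element of `C^∞(ℝ³)`. -/
def toSmooth : N →ₐ[ℝ] Smooth := MvPolynomial.aeval smoothCoord

lemma toSmooth_apply (F : N) (x : Fin 3 → ℝ) : (toSmooth F).1 x = MvPolynomial.eval x F := by
  induction F using MvPolynomial.induction_on with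
  | C a => simp [toSmooth]
  | add p q hp hq => simp [← hp, ← hq]
  | mul_X p i hp => simp [← hp]; left; simp [toSmooth, smoothCoord]

/-- The differential operator `∂^a = ∂₁^{a₁} ∂₂^{a₂} ∂₃^{a₃}` on `C^∞(ℝ³)`. -/
def multiD (a : Fin 3 → ℕ) : Module.End ℝ Smooth :=
  smoothD 0 ^ a 0 * smoothD 1 ^ a 1 * smoothD 2 ^ a 2

/-- Bidifferential operators on `C^∞(ℝ³)`: finite sums `∑ c_{ab} ∂^a F ∂^b G`, `c_{ab}` smooth. -/
def IsBidifferential (B : Smooth → Smooth → Smooth) : Prop :=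
  ∃ (s : Finset ((Fin 3 → ℕ) × (Fin 3 → ℕ))) (c : (Fin 3 → ℕ) × (Fin 3 → ℕ) → Smooth),
    ∀ F G, B F G = ∑ ab ∈ s, c ab * multiD ab.1 F * multiD ab.2 G

/-- `η_r` on `C^∞(ℝ³)`. -/
def etaSmooth (r : ℕ) : Module.End ℝ Smooth := etaOp smoothCoord smoothD r

/-- `B` is an extension of the sun product to `C^∞(ℝ³)` whose cochains (the coefficients of the
powers of `ν`) are bidifferential operators. -/
def IsSmoothExtension (B : Smooth → Smooth → Smooth⟦X⟧) : Prop :=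
  (∀ n, IsBidifferential fun F G => PowerSeries.coeff n (B F G)) ∧
  ∀ F G : N, B (toSmooth F) (toSmooth G) =
    PowerSeries.map toSmooth.toRingHom (sun (PowerSeries.C F) (PowerSeries.C G))

end

end SunProduct

open SunProduct

namespace SunProduct

noncomputable section

/-! ### The Moyal product with linear functions -/

/-! Well-definedness. Left Moyal multiplication by `L_i` is the operator `L_i + ν·rotD i + ν²·crossD
i`, and on functions of `L` it restricts to `L_i + ν·rot i + ν²·cross i`. Since `L_i ∗ (f ∗ g) =
(L_i ∗ f) ∗ g` (`moyalC_assoc_Lfun`), the cochains of `L_i F` are expressed through those of `F`,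
`rot i F` and `cross i F`. Induction on the degree of `F`, using Euler's identity, keeps them all
inside the image of the pullback.

Sun product. `α` is multiplicative, so the sun product is a linear function of `FG`, and powers
`l^k` of linear forms `l = ∑ a_i L_i` span the polynomials (`span_lin_pow`). On `l^k` the
symmetrization is trivial and `T ∘ α` gives the star power of `l`. The first-order term of `l ∗ l^n`
cancels by skew-symmetry, leaving `l ∗ l^n = l^(n+1) + ν² n(n+1)|a|² l^(n-1)`. The resulting
recurrence for the coefficients of star powers is the one satisfied by the Taylor coefficients of
`sec² tanⁿ`, because `(sec² tanⁿ)' = n sec² tanⁿ⁻¹ + (n+2) sec² tanⁿ⁺¹`. In closed form, the star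
exponential of `u l` is `sec²(ν|a|u) exp(l tan(ν|a|u) / (ν|a|))`.

Identification with `η_r`. With `sec x = ∑ γ_n x^(2n)` and `tan x = x ∑ τ_n x^(2n)`, `τ_0 = 1`,
expand `(1 + ∑_{n≥1} τ_n x^n)^n` binomially: the `p`-th term carries the falling factorial of `n`,
which is the eigenvalue of `D(D-1)⋯(D-p+1)` on `l^n`, and its coefficient is `z_{p,r}` by the
multinomial theorem (`coeff_secTan_eq_sum`). The factor `(n+2r)!/n!·|a|^(2r)` comes from `Δ^r
l^(n+2r)`.

Smooth functions. The formula itself defines an extension. It is the only one, since a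
bidifferential operator vanishing on polynomials vanishes: the monomials centred at a point detect
each coefficient there. -/

lemma pderiv_comm {σ : Type*} (a b : σ) (f : MvPolynomial σ ℝ) :
    MvPolynomial.pderiv a (MvPolynomial.pderiv b f) =
      MvPolynomial.pderiv b (MvPolynomial.pderiv a f) := by
  classical
  have h : ⁅MvPolynomial.pderiv (R := ℝ) a, MvPolynomial.pderiv (R := ℝ) b⁆ = 0 := by
    apply MvPolynomial.derivation_ext
    intro i
    simp only [Derivation.commutator_apply, MvPolynomial.pderiv_X, Derivation.coe_zero,
      Pi.zero_apply]
    rw [Pi.single_apply, Pi.single_apply]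
    split_ifs <;> simp
  have := DFunLike.congr_fun h f
  rwa [Derivation.commutator_apply, Derivation.coe_zero, Pi.zero_apply, sub_eq_zero] at this

/-- The Hamiltonian derivation `g ↦ {x_a, g}` of a coordinate function on `ℝ⁶`. -/
def hamD : Fin 3 ⊕ Fin 3 → Module.End ℝ N6
  | Sum.inl k => (MvPolynomial.pderiv (R := ℝ) (Sum.inr k : Fin 3 ⊕ Fin 3)).toLinearMap
  | Sum.inr k => -(MvPolynomial.pderiv (R := ℝ) (Sum.inl k : Fin 3 ⊕ Fin 3)).toLinearMap

lemma hamD_inl (k : Fin 3) (f : N6) :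
    hamD (Sum.inl k) f = MvPolynomial.pderiv (Sum.inr k) f := rfl

lemma hamD_inr (k : Fin 3) (f : N6) :
    hamD (Sum.inr k) f = -MvPolynomial.pderiv (Sum.inl k) f := rfl

lemma poissonOp_tmul (f g : N6) : poissonOp (f ⊗ₜ g) = ∑ k : Fin 3,
    (MvPolynomial.pderiv (Sum.inl k) f ⊗ₜ[ℝ] MvPolynomial.pderiv (Sum.inr k) g
      - MvPolynomial.pderiv (Sum.inr k) f ⊗ₜ[ℝ] MvPolynomial.pderiv (Sum.inl k) g) := by
  simp [poissonOp, LinearMap.sum_apply]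

lemma poissonOp_comp_mulX (a : Fin 3 ⊕ Fin 3) :
    poissonOp * TensorProduct.map (LinearMap.mulLeft ℝ (MvPolynomial.X a)) LinearMap.id =
      TensorProduct.map (LinearMap.mulLeft ℝ (MvPolynomial.X a)) LinearMap.id * poissonOp +
      TensorProduct.map LinearMap.id (hamD a) := by
  apply TensorProduct.ext'
  intro f g
  simp only [Module.End.mul_apply, TensorProduct.map_tmul, LinearMap.mulLeft_apply,
    LinearMap.id_apply, poissonOp_tmul, LinearMap.add_apply, map_sum, map_sub]
  rcases a with a | a <;> fin_cases a <;>
    simp [Fin.sum_univ_three, Derivation.leibniz, hamD, MvPolynomial.pderiv_X, Pi.single_apply,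
      TensorProduct.add_tmul, TensorProduct.tmul_neg] <;> abel

lemma commute_poissonOp_map (A B : Module.End ℝ N6)
    (hA : ∀ c f, A (MvPolynomial.pderiv c f) = MvPolynomial.pderiv c (A f))
    (hB : ∀ c f, B (MvPolynomial.pderiv c f) = MvPolynomial.pderiv c (B f)) :
    Commute poissonOp (TensorProduct.map A B) := by
  apply TensorProduct.ext'
  intro f g
  simp only [Module.End.mul_apply, TensorProduct.map_tmul, poissonOp_tmul, map_sum, map_sub, hA, hB]

lemma hamD_pderiv (a c : Fin 3 ⊕ Fin 3) (f : N6) :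
    hamD a (MvPolynomial.pderiv c f) = MvPolynomial.pderiv c (hamD a f) := by
  rcases a with a | a
  · exact pderiv_comm _ _ _
  · simp only [hamD_inr, map_neg]; rw [pderiv_comm]

/-- The commutator of `P` with multiplication by `x_a` in the first slot is `1 ⊗ hamD a`. It has
constant coefficients and so commutes with `P`; hence passing `x_a` through `P^(r+1)` acts like
differentiating a power. The factor `r + 1` is later absorbed by the factorial of the Moyal cochain.
-/
lemma poissonOp_pow_comp_mulX (a : Fin 3 ⊕ Fin 3) (r : ℕ) :
    poissonOp ^ (r + 1) *
        TensorProduct.map (LinearMap.mulLeft ℝ (MvPolynomial.X a)) LinearMap.id =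
      TensorProduct.map (LinearMap.mulLeft ℝ (MvPolynomial.X a)) LinearMap.id *
        poissonOp ^ (r + 1) +
      ((r + 1 : ℕ) : ℝ) • (poissonOp ^ r * TensorProduct.map LinearMap.id (hamD a)) := by
  have hc : Commute poissonOp (TensorProduct.map LinearMap.id (hamD a)) :=
    commute_poissonOp_map _ _ (fun _ _ => rfl) (hamD_pderiv a)
  induction r with
  | zero => simp [poissonOp_comp_mulX]
  | succ r ih =>
    rw [pow_succ', mul_assoc, ih, mul_add, ← mul_assoc, poissonOp_comp_mulX, add_mul, mul_assoc,
      ← pow_succ', mul_smul_comm, ← mul_assoc, ← pow_succ', add_assoc, ← (hc.pow_left (r + 1)).eq]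
    congr 1
    push_cast
    module

lemma moyalC_apply (r : ℕ) (f g : N6) : moyalC r f g =
    (r.factorial : ℝ)⁻¹ • LinearMap.mul' ℝ N6 ((poissonOp ^ r) (f ⊗ₜ g)) := by
  simp [moyalC]

lemma moyalC_zero (f g : N6) : moyalC 0 f g = f * g := by
  simp [moyalC_apply]

lemma mul'_map_mulLeft (x : N6) (t : N6 ⊗[ℝ] N6) :
    LinearMap.mul' ℝ N6 (TensorProduct.map (LinearMap.mulLeft ℝ x) LinearMap.id t) =
      x * LinearMap.mul' ℝ N6 t := by
  induction t with
  | zero => simp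
  | tmul f g => simp [mul_assoc]
  | add s t hs ht => simp only [map_add, hs, ht, mul_add]

lemma moyalC_succ_X_mul (r : ℕ) (a : Fin 3 ⊕ Fin 3) (f g : N6) :
    moyalC (r + 1) (MvPolynomial.X a * f) g =
      MvPolynomial.X a * moyalC (r + 1) f g + moyalC r f (hamD a g) := by
  have h := LinearMap.congr_fun (poissonOp_pow_comp_mulX a r) (f ⊗ₜ g)
  simp only [Module.End.mul_apply, TensorProduct.map_tmul, LinearMap.mulLeft_apply,
    LinearMap.id_apply, LinearMap.add_apply, LinearMap.smul_apply] at h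
  rw [moyalC_apply, h, map_add, mul'_map_mulLeft, map_smul, smul_add, moyalC_apply, moyalC_apply,
    mul_smul_comm, smul_smul, Nat.factorial_succ]
  congr 2
  have : ((r + 1 : ℕ) : ℝ) ≠ 0 := by positivity
  have : (r.factorial : ℝ) ≠ 0 := by positivity
  push_cast at *
  field_simp

lemma pderiv_mul' (a : Fin 3 ⊕ Fin 3) (t : N6 ⊗[ℝ] N6) :
    MvPolynomial.pderiv a (LinearMap.mul' ℝ N6 t) = LinearMap.mul' ℝ N6
      (TensorProduct.map (MvPolynomial.pderiv a).toLinearMap LinearMap.id t) +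
      LinearMap.mul' ℝ N6
      (TensorProduct.map LinearMap.id (MvPolynomial.pderiv a).toLinearMap t) := by
  induction t with
  | zero => simp
  | tmul f g => simp [Derivation.leibniz]; ring
  | add s t hs ht => simp only [map_add, hs, ht]; ring

lemma pderiv_moyalC (r : ℕ) (a : Fin 3 ⊕ Fin 3) (f g : N6) :
    MvPolynomial.pderiv a (moyalC r f g) =
      moyalC r (MvPolynomial.pderiv a f) g + moyalC r f (MvPolynomial.pderiv a g) := by
  have h₁ : Commute poissonOp
      (TensorProduct.map (MvPolynomial.pderiv a).toLinearMap LinearMap.id) :=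
    commute_poissonOp_map _ _ (fun _ _ => pderiv_comm _ _ _) (fun _ _ => rfl)
  have h₂ : Commute poissonOp
      (TensorProduct.map LinearMap.id (MvPolynomial.pderiv a).toLinearMap) :=
    commute_poissonOp_map _ _ (fun _ _ => rfl) (fun _ _ => pderiv_comm _ _ _)
  have e₁ := LinearMap.congr_fun (h₁.pow_left r).eq (f ⊗ₜ g)
  have e₂ := LinearMap.congr_fun (h₂.pow_left r).eq (f ⊗ₜ g)
  simp only [Module.End.mul_apply, TensorProduct.map_tmul, LinearMap.id_apply] at e₁ e₂
  simp only [moyalC_apply]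
  rw [Derivation.map_smul, pderiv_mul', ← e₁, ← e₂, smul_add]
  rfl

lemma hamD_moyalC (r : ℕ) (a : Fin 3 ⊕ Fin 3) (f g : N6) :
    hamD a (moyalC r f g) = moyalC r (hamD a f) g + moyalC r f (hamD a g) := by
  rcases a with a | a
  · exact pderiv_moyalC _ _ _ _
  · simp only [hamD_inr, pderiv_moyalC, map_neg, LinearMap.neg_apply]; ring

/-- Associativity `x_a ∗ (f ∗ g) = (x_a ∗ f) ∗ g` for a coordinate `x_a`, in degree `r + 1`. -/
lemma moyalC_assoc_X (r : ℕ) (a : Fin 3 ⊕ Fin 3) (f g : N6) :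
    moyalC (r + 1) (MvPolynomial.X a * f) g + moyalC r (hamD a f) g =
      MvPolynomial.X a * moyalC (r + 1) f g + hamD a (moyalC r f g) := by
  rw [moyalC_succ_X_mul, hamD_moyalC]; ring

lemma moyalC_one (r : ℕ) (g : N6) : moyalC (r + 1) 1 g = 0 := by
  have h : poissonOp (1 ⊗ₜ g) = 0 := by simp [poissonOp_tmul]
  rw [moyalC_apply, pow_succ, Module.End.mul_apply, h, map_zero, map_zero, smul_zero]

/-! ### The Moyal product with the functions `L_i` -/

lemma sum_eps {M : Type*} [AddCommGroup M] [Module ℝ M] (i : Fin 3) (f : Fin 3 → Fin 3 → M) :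
    ∑ j, ∑ k, eps i j k • f j k = f (i + 1) (i + 2) - f (i + 2) (i + 1) := by
  fin_cases i <;> simp [Fin.sum_univ_three, eps] <;> norm_num <;> abel

lemma Lfun_eq (i : Fin 3) :
    Lfun i = MvPolynomial.X (Sum.inl (i + 1)) * MvPolynomial.X (Sum.inr (i + 2)) -
      MvPolynomial.X (Sum.inl (i + 2)) * MvPolynomial.X (Sum.inr (i + 1)) := by
  simp only [Lfun, MvPolynomial.C_mul']
  exact sum_eps i _

lemma moyalC_one_assoc_pq {j k : Fin 3} (hjk : j ≠ k) (f g : N6) :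
    moyalC 1 (MvPolynomial.X (Sum.inl j) * MvPolynomial.X (Sum.inr k) * f) g +
      moyalC 0 (MvPolynomial.X (Sum.inr k) * MvPolynomial.pderiv (Sum.inr j) f
        - MvPolynomial.X (Sum.inl j) * MvPolynomial.pderiv (Sum.inl k) f) g =
    MvPolynomial.X (Sum.inl j) * MvPolynomial.X (Sum.inr k) * moyalC 1 f g +
      (MvPolynomial.X (Sum.inr k) * MvPolynomial.pderiv (Sum.inr j) (moyalC 0 f g)
        - MvPolynomial.X (Sum.inl j) * MvPolynomial.pderiv (Sum.inl k) (moyalC 0 f g)) := by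
  have e₁ := moyalC_assoc_X 0 (Sum.inl j) (MvPolynomial.X (Sum.inr k) * f) g
  have e₂ := moyalC_assoc_X 0 (Sum.inr k) f g
  simp only [hamD_inl, hamD_inr, moyalC_zero, zero_add, Derivation.leibniz, smul_eq_mul,
    MvPolynomial.pderiv_X, Pi.single_apply, Sum.inr.injEq, if_neg hjk.symm, mul_zero, add_zero]
    at e₁ e₂ ⊢
  rw [mul_assoc]
  linear_combination e₁ + MvPolynomial.X (Sum.inl j) * e₂

/-- For `j ≠ k` the product `p_j q_k` equals `p_j ∗ q_k`, so associativity for it is the composite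
of the two coordinate cases. Degree one is treated separately above, as there is no cochain of
degree `-1`. -/
lemma moyalC_assoc_pq {j k : Fin 3} (hjk : j ≠ k) (r : ℕ) (f g : N6) :
    moyalC (r + 2) (MvPolynomial.X (Sum.inl j) * MvPolynomial.X (Sum.inr k) * f) g +
      moyalC (r + 1) (MvPolynomial.X (Sum.inr k) * MvPolynomial.pderiv (Sum.inr j) f
        - MvPolynomial.X (Sum.inl j) * MvPolynomial.pderiv (Sum.inl k) f) g -
      moyalC r (MvPolynomial.pderiv (Sum.inr j) (MvPolynomial.pderiv (Sum.inl k) f)) g =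
    MvPolynomial.X (Sum.inl j) * MvPolynomial.X (Sum.inr k) * moyalC (r + 2) f g +
      (MvPolynomial.X (Sum.inr k) * MvPolynomial.pderiv (Sum.inr j) (moyalC (r + 1) f g)
        - MvPolynomial.X (Sum.inl j) * MvPolynomial.pderiv (Sum.inl k) (moyalC (r + 1) f g)) -
      MvPolynomial.pderiv (Sum.inr j) (MvPolynomial.pderiv (Sum.inl k) (moyalC r f g)) := by
  have hX : MvPolynomial.pderiv (Sum.inr j) (MvPolynomial.X (Sum.inr k) : N6) = 0 := by
    rw [MvPolynomial.pderiv_X_of_ne]; simpa using hjk.symm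
  have e₁ := moyalC_assoc_X (r + 1) (Sum.inl j) (MvPolynomial.X (Sum.inr k) * f) g
  have e₂ := moyalC_assoc_X (r + 1) (Sum.inr k) f g
  have e₃ := congrArg (MvPolynomial.pderiv (Sum.inr j)) (moyalC_assoc_X r (Sum.inr k) f g)
  have e₄ := moyalC_assoc_X r (Sum.inl j) (MvPolynomial.pderiv (Sum.inl k) f) g
  simp only [hamD_inl, hamD_inr, map_add, map_neg, LinearMap.neg_apply, Derivation.leibniz,
    smul_eq_mul, hX, mul_zero, add_zero] at e₁ e₂ e₃ e₄
  simp only [map_sub, LinearMap.sub_apply]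
  rw [mul_assoc]
  linear_combination e₁ + MvPolynomial.X (Sum.inl j) * e₂ + e₃ - e₄

/-- The derivation `{L_i, ·}` on `ℝ⁶`. -/
def rotD (i : Fin 3) (f : N6) : N6 :=
  MvPolynomial.X (Sum.inr (i + 2)) * MvPolynomial.pderiv (Sum.inr (i + 1)) f
    - MvPolynomial.X (Sum.inl (i + 1)) * MvPolynomial.pderiv (Sum.inl (i + 2)) f
    - (MvPolynomial.X (Sum.inr (i + 1)) * MvPolynomial.pderiv (Sum.inr (i + 2)) f
    - MvPolynomial.X (Sum.inl (i + 2)) * MvPolynomial.pderiv (Sum.inl (i + 1)) f)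

/-- The second order operator `C₂(L_i, ·)` on `ℝ⁶`. -/
def crossD (i : Fin 3) (f : N6) : N6 :=
  MvPolynomial.pderiv (Sum.inr (i + 2)) (MvPolynomial.pderiv (Sum.inl (i + 1)) f)
    - MvPolynomial.pderiv (Sum.inr (i + 1)) (MvPolynomial.pderiv (Sum.inl (i + 2)) f)

lemma moyalC_one_assoc_Lfun (i : Fin 3) (f g : N6) :
    moyalC 1 (Lfun i * f) g + rotD i f * g = Lfun i * moyalC 1 f g + rotD i (f * g) := by
  have h : i + 1 ≠ i + 2 := by fin_cases i <;> decide
  have e₁ := moyalC_one_assoc_pq h f g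
  have e₂ := moyalC_one_assoc_pq h.symm f g
  simp only [moyalC_zero] at e₁ e₂
  rw [Lfun_eq, sub_mul, map_sub, LinearMap.sub_apply, rotD, rotD]
  linear_combination e₁ - e₂

/-- Associativity `L_i ∗ (f ∗ g) = (L_i ∗ f) ∗ g`, in degree `r + 2`. -/
lemma moyalC_assoc_Lfun (r : ℕ) (i : Fin 3) (f g : N6) :
    moyalC (r + 2) (Lfun i * f) g + moyalC (r + 1) (rotD i f) g + moyalC r (crossD i f) g =
      Lfun i * moyalC (r + 2) f g + rotD i (moyalC (r + 1) f g) + crossD i (moyalC r f g) := by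
  have h : i + 1 ≠ i + 2 := by fin_cases i <;> decide
  have e₁ := moyalC_assoc_pq h r f g
  have e₂ := moyalC_assoc_pq h.symm r f g
  simp only [Lfun_eq, sub_mul, map_sub, LinearMap.sub_apply, rotD, crossD] at e₁ e₂ ⊢
  linear_combination e₁ - e₂

lemma rotD_one (i : Fin 3) : rotD i 1 = 0 := by simp [rotD]

lemma crossD_one (i : Fin 3) : crossD i 1 = 0 := by simp [crossD]

/-- Putting `f = 1` in the associativity relation isolates the cochains of `L_i` itself, since the
positive-degree cochains of `1` vanish. The same argument gives the two lemmas that follow. -/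
lemma moyalC_one_Lfun (i : Fin 3) (g : N6) : moyalC 1 (Lfun i) g = rotD i g := by
  simpa [rotD_one, moyalC_one 0] using moyalC_one_assoc_Lfun i 1 g

lemma moyalC_two_Lfun (i : Fin 3) (g : N6) : moyalC 2 (Lfun i) g = crossD i g := by
  have := moyalC_assoc_Lfun 0 i 1 g
  simpa [rotD_one, crossD_one, moyalC_one, moyalC_zero, rotD] using this

lemma moyalC_add_three_Lfun (r : ℕ) (i : Fin 3) (g : N6) : moyalC (r + 3) (Lfun i) g = 0 := by
  have := moyalC_assoc_Lfun (r + 1) i 1 g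
  simpa [rotD_one, crossD_one, moyalC_one, rotD, crossD] using this

/-! ### The induced operators on `ℝ³` -/

lemma pullback_X (i : Fin 3) : pullback (MvPolynomial.X i) = Lfun i := by simp [pullback]

lemma pderiv_pullback (a : Fin 3 ⊕ Fin 3) (F : N) :
    MvPolynomial.pderiv a (pullback F) =
      ∑ l, pullback (MvPolynomial.pderiv l F) * MvPolynomial.pderiv a (Lfun l) := by
  induction F using MvPolynomial.induction_on with
  | C c => simp [pullback]
  | add p q hp hq => simp only [map_add, hp, hq, add_mul, Finset.sum_add_distrib]
  | mul_X p i hp =>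
    have h : ∀ l, pullback (MvPolynomial.pderiv l (p * MvPolynomial.X i)) =
        pullback p * (if i = l then 1 else 0) + pullback (MvPolynomial.pderiv l p) * Lfun i := by
      intro l
      rw [Derivation.leibniz, smul_eq_mul, smul_eq_mul, map_add, map_mul, map_mul, pullback_X,
        MvPolynomial.pderiv_X, Pi.single_apply, mul_comm (Lfun i)]
      split_ifs <;> simp
    simp only [h, add_mul, Finset.sum_add_distrib]
    rw [map_mul, pullback_X, Derivation.leibniz, hp, smul_eq_mul, smul_eq_mul, Finset.mul_sum]
    refine congrArg₂ (· + ·) ?_ ?_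
    · simp
    · exact Finset.sum_congr rfl fun _ _ => by ring

/-- The derivation `{L_i, ·}` on `ℝ³`. -/
def rot (i : Fin 3) (F : N) : N :=
  MvPolynomial.X (i + 2) * MvPolynomial.pderiv (i + 1) F -
    MvPolynomial.X (i + 1) * MvPolynomial.pderiv (i + 2) F

/-- The second order operator `C₂(L_i, ·)` on `ℝ³`. -/
def cross (i : Fin 3) (F : N) : N :=
  2 * MvPolynomial.pderiv i F +
    ∑ j, MvPolynomial.X j * MvPolynomial.pderiv i (MvPolynomial.pderiv j F)

lemma rotD_pullback (i : Fin 3) (F : N) :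
    rotD i (pullback F) = pullback (rot i F) := by
  simp only [rotD, rot, pderiv_pullback, map_sub, map_mul, pullback_X, Lfun_eq]
  fin_cases i <;>
    simp [Fin.sum_univ_three, Derivation.leibniz, MvPolynomial.pderiv_X, Pi.single_apply] <;> ring

/-- Chain rule: the mixed second derivatives of `L_l` contribute only for `l = i`, giving the `2
∂_i`. The products of first derivatives of the `L`'s recombine into the coefficients `L_j` of the
second-order term. -/
lemma crossD_pullback (i : Fin 3) (F : N) :
    crossD i (pullback F) = pullback (cross i F) := by
  have h₂ : pullback 2 = 2 := map_ofNat pullback 2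
  have h₁₀ := pderiv_comm 1 0 F
  have h₂₀ := pderiv_comm 2 0 F
  have h₂₁ := pderiv_comm 2 1 F
  simp only [crossD, cross, pderiv_pullback, map_add, map_mul, Derivation.leibniz, smul_eq_mul,
    pullback_X, Lfun_eq, Fin.sum_univ_three]
  fin_cases i <;>
    simp [Derivation.leibniz, MvPolynomial.pderiv_X, h₂, h₁₀, h₂₀, h₂₁] <;> ring

/-! ### The star product on `ℝ³` is well defined -/

/-- The polynomials `F` such that all the Moyal cochains `C_r(F(L), G(L))` are functions of `L`. -/
def goodSubmodule : Submodule ℝ N where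
  carrier := {F | ∀ (r : ℕ) (G : N), moyalC r (pullback F) (pullback G) ∈ pullback.range}
  add_mem' {F F'} hF hF' r G := by
    rw [map_add, map_add, LinearMap.add_apply]
    exact add_mem (hF r G) (hF' r G)
  zero_mem' r G := by simp
  smul_mem' c F hF r G := by
    rw [map_smul, map_smul, LinearMap.smul_apply]
    exact Subalgebra.smul_mem _ (hF r G) c

/-- The associativity relation is solved for the top cochain of `L_i F`; every other term in it is a
pullback by assumption or because `rotD` and `crossD` preserve pullbacks. -/
lemma X_mul_mem_goodSubmodule (i : Fin 3) {F : N} (hF : F ∈ goodSubmodule)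
    (hrot : rot i F ∈ goodSubmodule) (hcross : cross i F ∈ goodSubmodule) :
    MvPolynomial.X i * F ∈ goodSubmodule := by
  intro r G
  rw [map_mul, pullback_X]
  match r with
  | 0 =>
    rw [moyalC_zero, ← pullback_X, ← map_mul, ← map_mul]
    exact ⟨_, rfl⟩
  | 1 =>
    have h := moyalC_one_assoc_Lfun i (pullback F) (pullback G)
    rw [rotD_pullback, ← map_mul, ← map_mul, rotD_pullback, ← pullback_X] at h
    obtain ⟨H, hH⟩ := hF 1 G
    rw [← hH] at h
    refine ⟨MvPolynomial.X i * H + rot i (F * G) - rot i F * G, ?_⟩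
    change pullback _ = _
    change _ = _ * pullback H + _ at h
    rw [← pullback_X, map_sub, map_add, map_mul pullback _ H, ← h]
    ring
  | r + 2 =>
    have h := moyalC_assoc_Lfun r i (pullback F) (pullback G)
    obtain ⟨H₂, h₂⟩ := hF (r + 2) G
    obtain ⟨H₁, h₁⟩ := hF (r + 1) G
    obtain ⟨H₀, h₀⟩ := hF r G
    obtain ⟨K₁, k₁⟩ := hrot (r + 1) G
    obtain ⟨K₀, k₀⟩ := hcross r G
    change pullback _ = _ at h₂ h₁ h₀ k₁ k₀
    rw [rotD_pullback, crossD_pullback, ← h₂, ← h₁, ← h₀, ← k₁, ← k₀, rotD_pullback,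
      crossD_pullback] at h
    refine ⟨MvPolynomial.X i * H₂ + rot i H₁ + cross i H₀ - K₁ - K₀, ?_⟩
    change pullback _ = _
    rw [map_sub, map_sub, map_add, map_add, map_mul, pullback_X, ← h]
    ring

lemma C_mem_goodSubmodule (c : ℝ) : MvPolynomial.C c ∈ goodSubmodule := by
  have h1 : (1 : N) ∈ goodSubmodule := by
    intro r G
    rw [map_one]
    cases r with
    | zero => rw [moyalC_zero, one_mul]; exact ⟨_, rfl⟩
    | succ r => rw [moyalC_one]; exact zero_mem _
  simpa [MvPolynomial.C_eq_smul_one] using goodSubmodule.smul_mem c h1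

/-- By Euler's identity a form of positive degree is, up to a scalar, a sum of terms `X_i H` with
`H` of degree one less. For such an `H`, `rot` preserves the degree and `cross` lowers it, so strong
induction covers all three hypotheses of `X_mul_mem_goodSubmodule`. -/
lemma mem_goodSubmodule_of_isHomogeneous (n : ℕ) :
    ∀ F : N, F.IsHomogeneous n → F ∈ goodSubmodule := by
  induction n using Nat.strong_induction_on with
  | _ n ih =>
  intro F hF
  have hconst : ∀ H : N, H.IsHomogeneous 0 → ∃ c, H = MvPolynomial.C c := fun H hH =>
    ⟨_, MvPolynomial.totalDegree_eq_zero_iff_eq_C.1 (Nat.le_zero.1 hH.totalDegree_le)⟩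
  cases n with
  | zero =>
    obtain ⟨c, rfl⟩ := hconst F hF
    exact C_mem_goodSubmodule c
  | succ n =>
    have hE := hF.sum_X_mul_pderiv
    have hmem : ∑ i, MvPolynomial.X i * MvPolynomial.pderiv i F ∈ goodSubmodule := by
      refine Submodule.sum_mem _ fun i _ => ?_
      have hH : (MvPolynomial.pderiv i F).IsHomogeneous n := hF.pderiv
      revert hH
      generalize MvPolynomial.pderiv i F = H
      intro hH
      cases n with
      | zero =>
        obtain ⟨c, rfl⟩ := hconst H hH
        apply X_mul_mem_goodSubmodule i (C_mem_goodSubmodule c) <;> simp [rot, cross]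
      | succ n =>
        have hd : ∀ j, (MvPolynomial.pderiv j H).IsHomogeneous n := fun j => hH.pderiv
        have hX : ∀ j l, (MvPolynomial.X j * MvPolynomial.pderiv l H) ∈ goodSubmodule :=
          fun j l => ih (n + 1) (by omega) _
            (by simpa [add_comm] using (MvPolynomial.isHomogeneous_X ℝ j).mul (hd l))
        apply X_mul_mem_goodSubmodule i (ih (n + 1) (by omega) H hH)
        · exact Submodule.sub_mem _ (hX _ _) (hX _ _)
        · have h2 : (2 : N) * MvPolynomial.pderiv i H = (2 : ℝ) • MvPolynomial.pderiv i H := by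
            rw [two_smul, two_mul]
          rw [cross, h2]
          refine Submodule.add_mem _ (Submodule.smul_mem _ _ (ih n (by omega) _ (hd i)))
            (Submodule.sum_mem _ fun j _ => ?_)
          -- When `H` is linear its second derivatives vanish; the degree count below needs `H` of
          -- degree at least two.
          cases n with
          | zero =>
            obtain ⟨c, hc⟩ := hconst _ (hd j)
            simp [hc]
          | succ n =>
            exact ih (n + 1) (by omega) _
              (by simpa [add_comm] using
                (MvPolynomial.isHomogeneous_X ℝ j).mul ((hd j).pderiv (i := i)))
    rw [hE] at hmem
    have := goodSubmodule.smul_mem ((n + 1 : ℝ)⁻¹) hmem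
    rw [← Nat.cast_smul_eq_nsmul ℝ, smul_smul] at this
    push_cast at this
    rwa [inv_mul_cancel₀ (by positivity), one_smul] at this

lemma mem_goodSubmodule (F : N) : F ∈ goodSubmodule := by
  rw [← MvPolynomial.sum_homogeneousComponent F]
  exact Submodule.sum_mem _ fun n _ => mem_goodSubmodule_of_isHomogeneous n _
    (MvPolynomial.homogeneousComponent_isHomogeneous n F)

lemma pullback_starC (r : ℕ) (F G : N) :
    pullback (starC r F G) = moyalC r (pullback F) (pullback G) := by
  obtain ⟨H, hH⟩ := mem_goodSubmodule F r G
  change pullback H = _ at hH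
  simp [starC, ← hH, pullbackInv_pullback]

lemma coeff_starProd_C (n : ℕ) (F : N) (H : N⟦X⟧) :
    PowerSeries.coeff n (starProd (PowerSeries.C F) H) =
      ∑ a ∈ Finset.HasAntidiagonal.antidiagonal n, starC a.1 F (PowerSeries.coeff a.2 H) := by
  simp only [starProd, LinearMap.mk₂_apply, PowerSeries.coeff_mk]
  refine Finset.sum_congr rfl fun a _ => ?_
  rw [Finset.sum_eq_single (0, a.2)]
  · simp
  · rintro ⟨b, c⟩ hb hne
    have : b ≠ 0 := by
      rintro rfl
      apply hne
      simp at hb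
      simp [hb]
    simp [PowerSeries.coeff_C, this]
  · simp

lemma coeff_starProd_C_C (n : ℕ) (F G : N) :
    PowerSeries.coeff n (starProd (PowerSeries.C F) (PowerSeries.C G)) = starC n F G := by
  rw [coeff_starProd_C, Finset.sum_eq_single (n, 0)]
  · simp
  · rintro ⟨b, c⟩ hb hne
    have : c ≠ 0 := by
      rintro rfl
      apply hne
      simp at hb
      simp [hb]
    simp [PowerSeries.coeff_C, this]
  · simp

theorem map_pullback_starProd (F G : N) :
    PowerSeries.map pullback.toRingHom (starProd (PowerSeries.C F) (PowerSeries.C G)) =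
      moyal (pullback F) (pullback G) := by
  ext1 n
  rw [PowerSeries.coeff_map, coeff_starProd_C_C, moyal, PowerSeries.coeff_mk]
  exact pullback_starC n F G

lemma starC_zero_X (i : Fin 3) (F : N) :
    starC 0 (MvPolynomial.X i) F = MvPolynomial.X i * F :=
  pullback_injective (by rw [pullback_starC, moyalC_zero, map_mul])

lemma starC_one_X (i : Fin 3) (F : N) : starC 1 (MvPolynomial.X i) F = rot i F :=
  pullback_injective (by rw [pullback_starC, pullback_X, moyalC_one_Lfun, rotD_pullback])

lemma starC_two_X (i : Fin 3) (F : N) : starC 2 (MvPolynomial.X i) F = cross i F :=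
  pullback_injective (by rw [pullback_starC, pullback_X, moyalC_two_Lfun, crossD_pullback])

lemma starC_add_three_X (r : ℕ) (i : Fin 3) (F : N) : starC (r + 3) (MvPolynomial.X i) F = 0 :=
  pullback_injective (by rw [pullback_starC, pullback_X, moyalC_add_three_Lfun, map_zero])

theorem starProd_X (i : Fin 3) (F : N) :
    starProd (PowerSeries.C (MvPolynomial.X i)) (PowerSeries.C F) =
      PowerSeries.C (MvPolynomial.X i * F) +
      PowerSeries.X * PowerSeries.C
        (∑ j, ∑ k, MvPolynomial.C (eps i j k) * MvPolynomial.X k * MvPolynomial.pderiv j F) +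
      PowerSeries.X ^ 2 * PowerSeries.C
        (2 * MvPolynomial.pderiv i F +
          ∑ j, MvPolynomial.X j * MvPolynomial.pderiv i (MvPolynomial.pderiv j F)) := by
  have hrot : ∑ j, ∑ k, MvPolynomial.C (eps i j k) * MvPolynomial.X k * MvPolynomial.pderiv j F =
      rot i F := by
    simp only [MvPolynomial.C_mul', smul_mul_assoc]
    exact sum_eps i fun j k => MvPolynomial.X k * MvPolynomial.pderiv j F
  have hcross : 2 * MvPolynomial.pderiv i F +
      ∑ j, MvPolynomial.X j * MvPolynomial.pderiv i (MvPolynomial.pderiv j F) = cross i F := rfl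
  rw [hrot, hcross]
  ext1 n
  rw [coeff_starProd_C_C]
  match n with
  | 0 => simp [starC_zero_X]
  | 1 => simp [starC_one_X, PowerSeries.coeff_X_pow]
  | 2 => simp [starC_two_X, PowerSeries.coeff_X]
  | n + 3 => simp [starC_add_three_X, PowerSeries.coeff_X, PowerSeries.coeff_X_pow]

/-! ### The power series of `sec` and `tan` -/

/-- The power series of the secant. -/
def secSeries : ℝ⟦X⟧ := (PowerSeries.cos ℝ)⁻¹

/-- The power series of the tangent. -/
def tanSeries : ℝ⟦X⟧ := PowerSeries.sin ℝ * secSeries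

lemma cos_mul_secSeries : PowerSeries.cos ℝ * secSeries = 1 :=
  PowerSeries.mul_inv_cancel _ (by simp [PowerSeries.cos])

lemma derivative_sin : PowerSeries.derivative ℝ (PowerSeries.sin ℝ) = PowerSeries.cos ℝ := by
  ext n
  simp only [PowerSeries.coeff_derivative, PowerSeries.sin, PowerSeries.cos, PowerSeries.coeff_mk,
    Nat.even_add_one]
  by_cases h : Even n
  · obtain ⟨m, rfl⟩ := h
    have : (m + m + 1) / 2 = (m + m) / 2 := by omega
    simp only [this, Even.add_self, not_true_eq_false, if_true, if_false, Nat.factorial_succ]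
    push_cast
    field_simp
  · simp [h]

lemma derivative_cos : PowerSeries.derivative ℝ (PowerSeries.cos ℝ) = -PowerSeries.sin ℝ := by
  ext n
  simp only [PowerSeries.coeff_derivative, PowerSeries.sin, PowerSeries.cos, PowerSeries.coeff_mk,
    Nat.even_add_one, map_neg]
  by_cases h : Even n
  · simp [h]
  · obtain ⟨m, rfl⟩ := Nat.not_even_iff_odd.1 h
    have h₁ : (2 * m + 1 + 1) / 2 = m + 1 := by omega
    have h₂ : (2 * m + 1) / 2 = m := by omega
    simp only [h, h₁, h₂, not_false_eq_true, if_true, if_false, Nat.factorial_succ (2 * m + 1),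
      eq_ratCast]
    push_cast
    field_simp
    ring

lemma derivative_secSeries :
    PowerSeries.derivative ℝ secSeries = secSeries * tanSeries := by
  rw [tanSeries, secSeries, PowerSeries.derivative_inv', derivative_cos]
  ring

lemma derivative_tanSeries : PowerSeries.derivative ℝ tanSeries = 1 + tanSeries ^ 2 := by
  have h := cos_mul_secSeries
  have h₁ : PowerSeries.derivative ℝ tanSeries =
      PowerSeries.sin ℝ * (secSeries * tanSeries) + secSeries * PowerSeries.cos ℝ := by
    rw [← derivative_secSeries, ← derivative_sin]
    exact Derivation.leibniz _ _ _
  rw [h₁, tanSeries]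
  linear_combination h

/-- The power series of `sec² tanⁿ`. -/
def secTan (n : ℕ) : ℝ⟦X⟧ := secSeries ^ 2 * tanSeries ^ n

lemma derivative_secTan_zero : PowerSeries.derivative ℝ (secTan 0) = 2 * secTan 1 := by
  simp only [secTan, pow_zero, mul_one, pow_one, Derivation.leibniz_pow, derivative_secSeries,
    smul_eq_mul, nsmul_eq_mul, Nat.cast_ofNat, Nat.add_one_sub_one]
  ring

/-- Read on coefficients, this is the recurrence of the star powers of a linear form; see
`powCoeff_succ`. -/
lemma derivative_secTan_succ (n : ℕ) : PowerSeries.derivative ℝ (secTan (n + 1)) =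
    (n + 1 : ℝ) • secTan n + (n + 3 : ℝ) • secTan (n + 2) := by
  simp only [secTan, Derivation.leibniz, Derivation.leibniz_pow, derivative_secSeries,
    derivative_tanSeries, smul_eq_mul, PowerSeries.smul_eq_C_mul, map_add, map_natCast, map_ofNat,
    map_one, nsmul_eq_mul]
  simp only [Nat.add_sub_cancel, Nat.cast_add, Nat.cast_ofNat, Nat.cast_one]
  ring

lemma coeff_secTan_zero (k : ℕ) : (k + 1 : ℝ) * PowerSeries.coeff (k + 1) (secTan 0) =
    2 * PowerSeries.coeff k (secTan 1) := by
  have h := congrArg (PowerSeries.coeff k) derivative_secTan_zero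
  rw [PowerSeries.coeff_derivative, ← map_ofNat (PowerSeries.C (R := ℝ)) 2,
    PowerSeries.coeff_C_mul] at h
  linarith

lemma coeff_secTan_succ (n k : ℕ) : (k + 1 : ℝ) * PowerSeries.coeff (k + 1) (secTan (n + 1)) =
    (n + 1) * PowerSeries.coeff k (secTan n) + (n + 3) * PowerSeries.coeff k (secTan (n + 2)) := by
  have h := congrArg (PowerSeries.coeff k) (derivative_secTan_succ n)
  rw [PowerSeries.coeff_derivative, map_add, PowerSeries.coeff_smul, PowerSeries.coeff_smul] at h
  simp only [smul_eq_mul] at h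
  linarith

/-! ### The coefficients of `sec` and `tan` -/

lemma cos_eq_expand : PowerSeries.cos ℝ = PowerSeries.expand 2 two_ne_zero
    (PowerSeries.mk fun n => PowerSeries.coeff (2 * n) (PowerSeries.cos ℝ)) := by
  ext n
  rw [PowerSeries.coeff_expand]
  split_ifs with h
  · obtain ⟨m, rfl⟩ := h
    simp
  · simp [PowerSeries.cos, even_iff_two_dvd, h]

/-- The reciprocal of a series in `X²` is again one, so `sec` is determined by its even
coefficients. -/
lemma secSeries_eq_expand :
    secSeries = PowerSeries.expand 2 two_ne_zero (PowerSeries.mk gam) := by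
  set c : ℝ⟦X⟧ := PowerSeries.mk fun n => PowerSeries.coeff (2 * n) (PowerSeries.cos ℝ) with hc
  have hc0 : PowerSeries.constantCoeff c ≠ 0 := by
    simp [hc, PowerSeries.cos]
  have h : secSeries = PowerSeries.expand 2 two_ne_zero c⁻¹ := by
    have h₁ : PowerSeries.cos ℝ * PowerSeries.expand 2 two_ne_zero c⁻¹ = 1 := by
      rw [cos_eq_expand, ← hc, ← map_mul, PowerSeries.mul_inv_cancel _ hc0, map_one]
    linear_combination (-secSeries) * h₁ +
      PowerSeries.expand 2 two_ne_zero c⁻¹ * cos_mul_secSeries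
  rw [h]
  congr 1
  ext n
  rw [PowerSeries.coeff_mk, gam, eulerNumber, mul_div_cancel_left₀ _ (by positivity)]
  change _ = PowerSeries.coeff (2 * n) secSeries
  rw [h, PowerSeries.coeff_expand_mul]

lemma mk_coefA : PowerSeries.mk coefA = PowerSeries.mk gam ^ 2 := by
  ext n
  simp [sq, PowerSeries.coeff_mul, coefA]

/-- The sign is read off from Euler's formula for `ζ(2n+2)`, a sum of nonnegative terms. -/
lemma abs_bernoulli (n : ℕ) :
    |(bernoulli (2 * n + 2) : ℝ)| = (-1) ^ n * (bernoulli (2 * n + 2) : ℝ) := by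
  have h := (hasSum_zeta_nat (k := n + 1) (by omega)).nonneg fun m => by positivity
  have h₁ : (0 : ℝ) ≤ (-1) ^ n * (bernoulli (2 * n + 2) : ℝ) := by
    rw [show 2 * (n + 1) = 2 * n + 2 by ring] at h
    have h₂ : (0 : ℝ) < 2 ^ (2 * n + 2 - 1) * Real.pi ^ (2 * n + 2) / (2 * n + 2).factorial := by
      positivity
    refine nonneg_of_mul_nonneg_right (b := _) ?_ h₂
    convert h using 1
    ring
  rw [← abs_of_nonneg h₁, abs_mul, abs_pow, abs_neg, abs_one, one_pow, one_mul]

lemma exp_rescale_I (s : ℂ) (hs : s ^ 2 = -1) : PowerSeries.rescale s (PowerSeries.exp ℂ) =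
    PowerSeries.cos ℂ + PowerSeries.C s * PowerSeries.sin ℂ := by
  ext n
  rw [map_add, PowerSeries.coeff_C_mul, PowerSeries.coeff_rescale, PowerSeries.coeff_exp,
    PowerSeries.cos, PowerSeries.sin, PowerSeries.coeff_mk, PowerSeries.coeff_mk]
  rcases Nat.even_or_odd' n with ⟨m, rfl | rfl⟩
  · have h : 2 * m / 2 = m := by omega
    simp [h, pow_mul, hs, div_eq_mul_inv]
  · have h : (2 * m + 1) / 2 = m := by omega
    simp [h, pow_mul, pow_succ, hs, div_eq_mul_inv]
    ring

/-- With `b(z) = z/(e^z - 1)` one has `b(4ix) - b(2ix) = -2ix/(e^(2ix) + 1) = -ix - x tan x`;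
denominators are cleared to stay within power series. -/
lemma bernoulliSeries_mul_cos :
    (PowerSeries.rescale (4 * Complex.I) (bernoulliPowerSeries ℂ) -
      PowerSeries.rescale (2 * Complex.I) (bernoulliPowerSeries ℂ) +
      PowerSeries.C Complex.I * PowerSeries.X) * PowerSeries.cos ℂ =
      -(PowerSeries.X * PowerSeries.sin ℂ) := by
  set e := PowerSeries.rescale Complex.I (PowerSeries.exp ℂ) with he
  set e' := PowerSeries.rescale (-Complex.I) (PowerSeries.exp ℂ) with he'
  have h1 : e * e' = 1 := by
    rw [he, he', PowerSeries.exp_mul_exp_eq_exp_add, add_neg_cancel]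
    simp
  have h2 : PowerSeries.rescale (2 * Complex.I) (PowerSeries.exp ℂ) = e ^ 2 := by
    rw [sq, he, PowerSeries.exp_mul_exp_eq_exp_add, two_mul]
  have h4 : PowerSeries.rescale (4 * Complex.I) (PowerSeries.exp ℂ) = e ^ 4 := by
    rw [show (4 : ℕ) = 2 + 2 by rfl, pow_add, ← h2, PowerSeries.exp_mul_exp_eq_exp_add]
    congr 2
    ring
  have b2 := congrArg (PowerSeries.rescale (2 * Complex.I))
    (bernoulliPowerSeries_mul_exp_sub_one ℂ)
  have b4 := congrArg (PowerSeries.rescale (4 * Complex.I))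
    (bernoulliPowerSeries_mul_exp_sub_one ℂ)
  rw [map_mul, map_sub, h2, map_one, PowerSeries.rescale_X] at b2
  rw [map_mul, map_sub, h4, map_one, PowerSeries.rescale_X] at b4
  have ec := exp_rescale_I Complex.I (by simp)
  have ec' := exp_rescale_I (-Complex.I) (by simp)
  rw [← he] at ec
  rw [← he'] at ec'
  simp only [map_neg, map_mul, map_ofNat] at ec' b2 b4
  set i := PowerSeries.C (R := ℂ) Complex.I
  have hi : i ^ 2 = -1 := by rw [← map_pow]; simp
  set B2 := PowerSeries.rescale (2 * Complex.I) (bernoulliPowerSeries ℂ)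
  set B4 := PowerSeries.rescale (4 * Complex.I) (bernoulliPowerSeries ℂ)
  -- Needed to cancel the common factor of `e⁴ - 1` and `e² - 1`; otherwise `b2` would make `2iX`
  -- vanish.
  have hne : e ^ 2 - 1 ≠ 0 := by
    intro h
    have := congrArg (PowerSeries.coeff 1) b2
    rw [h] at this
    simp [i, ← map_ofNat (PowerSeries.C (R := ℂ)), mul_assoc] at this
  have hG : (B4 - B2) * (e ^ 2 + 1) = -(2 * i * PowerSeries.X) := by
    apply mul_right_cancel₀ hne
    linear_combination b4 - (e ^ 2 + 1) * b2
  have hcos : 2 * PowerSeries.cos ℂ = e + e' := by rw [ec, ec']; ring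
  have hG' : (B4 - B2) * (2 * PowerSeries.cos ℂ) = -(2 * i * PowerSeries.X) * e' := by
    rw [← hG, hcos]
    linear_combination (-(B4 - B2) * e) * h1
  have h2ne : (2 : ℂ⟦X⟧) ≠ 0 := by
    rw [← map_ofNat (PowerSeries.C (R := ℂ))]
    simp
  apply mul_left_cancel₀ h2ne
  rw [ec'] at hG'
  linear_combination hG' + 2 * PowerSeries.X * PowerSeries.sin ℂ * hi

lemma tanSeries_eq_expand :
    tanSeries = PowerSeries.X * PowerSeries.expand 2 two_ne_zero (PowerSeries.mk tau) := by
  -- `X² V` is compared with the Bernoulli expression for `x tan x` coefficientwise: the linear term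
  -- `iX` cancels the contribution of `B₁`, and the other odd Bernoulli numbers vanish.
  set V : ℝ⟦X⟧ := PowerSeries.expand 2 two_ne_zero (PowerSeries.mk tau) with hV
  have key : PowerSeries.X ^ 2 * PowerSeries.map (algebraMap ℝ ℂ) V =
      -(PowerSeries.rescale (4 * Complex.I) (bernoulliPowerSeries ℂ) -
      PowerSeries.rescale (2 * Complex.I) (bernoulliPowerSeries ℂ) +
      PowerSeries.C Complex.I * PowerSeries.X) := by
    ext m
    rw [map_neg, map_add, map_sub, PowerSeries.coeff_rescale, PowerSeries.coeff_rescale,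
      PowerSeries.coeff_C_mul, PowerSeries.coeff_X, bernoulliPowerSeries, PowerSeries.coeff_mk]
    match m with
    | 0 => simp [sq, mul_assoc]
    | 1 =>
      simp [PowerSeries.coeff_X_pow_mul']
      ring
    | m + 2 =>
      rw [PowerSeries.coeff_X_pow_mul, PowerSeries.coeff_map, hV, PowerSeries.coeff_expand]
      split_ifs with h h' h'
      · omega
      · obtain ⟨n, rfl⟩ := h
        rw [show 2 * n / 2 = n by omega, PowerSeries.coeff_mk, tau, abs_bernoulli]
        have h4 : (4 * Complex.I) ^ (2 * n + 2) = 2 ^ (2 * n + 2) * 2 ^ (2 * n + 2) * -(-1) ^ n := by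
          rw [mul_pow, show (4 : ℂ) = 2 * 2 by norm_num, mul_pow,
            show 2 * n + 2 = 2 * (n + 1) by ring, pow_mul Complex.I, Complex.I_sq]
          ring
        have h2 : (2 * Complex.I) ^ (2 * n + 2) = 2 ^ (2 * n + 2) * -(-1) ^ n := by
          rw [mul_pow, show 2 * n + 2 = 2 * (n + 1) by ring, pow_mul Complex.I, Complex.I_sq]
          ring
        rw [h4, h2]
        simp
        ring
      · omega
      · have : bernoulli (m + 2) = 0 :=
          bernoulli_eq_zero_of_odd (by
            rw [← Nat.not_even_iff_odd, even_iff_two_dvd]; omega) (by omega)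
        simp [this]
  have h := bernoulliSeries_mul_cos
  have hX : (PowerSeries.X : ℂ⟦X⟧) ≠ 0 := PowerSeries.X_ne_zero
  have h₁ : PowerSeries.map (algebraMap ℝ ℂ) (PowerSeries.X * V * PowerSeries.cos ℝ) =
      PowerSeries.map (algebraMap ℝ ℂ) (PowerSeries.sin ℝ) := by
    apply mul_left_cancel₀ hX
    simp only [map_mul, PowerSeries.map_X, PowerSeries.map_cos, PowerSeries.map_sin]
    linear_combination PowerSeries.cos ℂ * key - h
  have h₂ : PowerSeries.X * V * PowerSeries.cos ℝ = PowerSeries.sin ℝ :=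
    PowerSeries.map_injective _ (algebraMap ℝ ℂ).injective h₁
  rw [tanSeries, ← h₂, mul_assoc, cos_mul_secSeries, mul_one]

lemma coeff_secTan (n r : ℕ) : PowerSeries.coeff (n + 2 * r) (secTan n) =
    PowerSeries.coeff r (PowerSeries.mk coefA * PowerSeries.mk tau ^ n) := by
  rw [secTan, secSeries_eq_expand, tanSeries_eq_expand, mul_pow, mul_left_comm, ← map_pow,
    ← map_pow, ← map_mul, add_comm, PowerSeries.coeff_X_pow_mul, PowerSeries.coeff_expand_mul,
    mk_coefA]

lemma coeff_secTan_of_odd (n : ℕ) {m : ℕ} (hm : ¬ Even m) :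
    PowerSeries.coeff (n + m) (secTan n) = 0 := by
  rw [secTan, secSeries_eq_expand, tanSeries_eq_expand, mul_pow, mul_left_comm, ← map_pow,
    ← map_pow, ← map_mul, add_comm, PowerSeries.coeff_X_pow_mul,
    PowerSeries.coeff_expand_of_not_dvd _ _ _ (by rwa [← even_iff_two_dvd])]

/-! ### The coefficients `z_{p,r}` -/

/-- The power series `∑_{n ≥ 1} τ_n X^n`. -/
def tauTail : ℝ⟦X⟧ := PowerSeries.mk fun n => if n = 0 then 0 else tau n

lemma tau_zero : tau 0 = 1 := by
  rw [tau, bernoulli_two]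
  norm_num [abs_of_pos]

lemma mk_tau : PowerSeries.mk tau = tauTail + 1 := by
  ext n
  cases n <;> simp [tauTail, tau_zero, PowerSeries.coeff_one]

/-- Congruence modulo `X^(k+1)` passes to powers. This allows an infinite series to be truncated to
a finite sum before applying the multinomial theorem. -/
lemma coeff_pow_congr {f g : ℝ⟦X⟧} {k : ℕ}
    (h : ∀ m ≤ k, PowerSeries.coeff m f = PowerSeries.coeff m g) (p : ℕ) :
    PowerSeries.coeff k (f ^ p) = PowerSeries.coeff k (g ^ p) := by
  have h₁ : (PowerSeries.X : ℝ⟦X⟧) ^ (k + 1) ∣ f - g := by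
    rw [PowerSeries.X_pow_dvd_iff]
    intro m hm
    rw [map_sub, h m (by omega), sub_self]
  have h₂ := PowerSeries.X_pow_dvd_iff.1 (h₁.trans (sub_dvd_pow_sub_pow f g p)) k (by omega)
  rwa [map_sub, sub_eq_zero] at h₂

lemma prod_map_C_mul_X_pow (s : Multiset ℕ) :
    (s.map fun i => PowerSeries.C (tau i) * PowerSeries.X ^ i).prod =
      PowerSeries.C (s.map tau).prod * (PowerSeries.X : ℝ⟦X⟧) ^ s.sum := by
  induction s using Multiset.induction_on with
  | empty => simp
  | cons a s ih =>
    simp only [Multiset.map_cons, Multiset.prod_cons, Multiset.sum_cons, ih, map_mul, pow_add]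
    ring

lemma prod_factorial_mul_countPerms {s : Multiset ℕ} {r : ℕ} (hs : ∀ i ∈ s, i ∈ Finset.Icc 1 r) :
    (∏ i ∈ Finset.Icc 1 r, (s.count i).factorial) * s.countPerms = s.card.factorial := by
  have hsupp : s.toFinsupp.support ⊆ Finset.Icc 1 r := by
    intro i hi
    exact hs i (by simpa using hi)
  rw [Multiset.countPerms, Finsupp.multinomial_eq_of_support_subset hsupp]
  have := Nat.multinomial_spec (Finset.Icc 1 r) s.toFinsupp
  simp only [Multiset.toFinsupp_apply] at this
  convert this using 2
  exact (Multiset.sum_count_eq_card hs).symm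

/-- Multinomial theorem: a multiset of `p` parts occurs `p!/∏ m_i!` times in the `p`-th power, and
contributes to `X^k` exactly when its sum is `k`. Parts larger than `r` cannot occur as `k ≤ r`. -/
lemma sum_partition_tau {k r : ℕ} (hk : k ≤ r) (p : ℕ) :
    ∑ n ∈ (Finset.univ : Finset k.Partition).filter (fun n => n.parts.card = p),
      (∏ i ∈ Finset.Icc 1 r, ((n.parts.count i).factorial : ℝ))⁻¹ * (n.parts.map tau).prod =
    (p.factorial : ℝ)⁻¹ * PowerSeries.coeff k (tauTail ^ p) := by
  have h : PowerSeries.coeff k (tauTail ^ p) = PowerSeries.coeff k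
      ((∑ i ∈ Finset.Icc 1 r, PowerSeries.C (tau i) * (PowerSeries.X : ℝ⟦X⟧) ^ i) ^ p) := by
    refine coeff_pow_congr (fun m hm => ?_) p
    have hm' : m ≤ r := hm.trans hk
    simp only [tauTail, PowerSeries.coeff_mk, map_sum, PowerSeries.coeff_C_mul,
      PowerSeries.coeff_X_pow, mul_ite, mul_one, mul_zero, Finset.sum_ite_eq, Finset.mem_Icc, hm',
      and_true, Nat.one_le_iff_ne_zero, ite_not]
  rw [h, Finset.sum_pow, map_sum, Finset.mul_sum]
  simp only [prod_map_C_mul_X_pow]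
  have hterm : ∀ s ∈ (Finset.Icc 1 r).sym p, (p.factorial : ℝ)⁻¹ * PowerSeries.coeff k
      ((s.val.countPerms : ℝ⟦X⟧) *
        (PowerSeries.C (s.val.map tau).prod * (PowerSeries.X : ℝ⟦X⟧) ^ s.val.sum)) =
      if s.val.sum = k then
        (∏ i ∈ Finset.Icc 1 r, ((s.val.count i).factorial : ℝ))⁻¹ * (s.val.map tau).prod
      else 0 := by
    intro s hs
    have hs' := prod_factorial_mul_countPerms (s := s.val) (r := r)
      (fun i hi => Finset.mem_sym_iff.1 hs i hi)
    rw [s.2] at hs'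
    have hs'' : (∏ i ∈ Finset.Icc 1 r, ((s.val.count i).factorial : ℝ)) * s.val.countPerms =
        p.factorial := by exact_mod_cast hs'
    rw [← map_natCast (PowerSeries.C (R := ℝ)), PowerSeries.coeff_C_mul, PowerSeries.coeff_C_mul,
      PowerSeries.coeff_X_pow]
    by_cases hk' : s.val.sum = k
    · have h₁ : (∏ i ∈ Finset.Icc 1 r, ((s.val.count i).factorial : ℝ)) ≠ 0 := by positivity
      have h₂ : (p.factorial : ℝ) ≠ 0 := by positivity
      rw [if_pos hk', if_pos hk'.symm]
      field_simp
      rw [← hs'']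
      ring
    · rw [if_neg hk', if_neg (Ne.symm hk')]
      simp
  rw [Finset.sum_congr rfl hterm, ← Finset.sum_filter]
  refine Finset.sum_bij (fun n hn => ⟨n.parts, (Finset.mem_filter.1 hn).2⟩) ?_ ?_ ?_ ?_
  · intro n hn
    refine Finset.mem_filter.2 ⟨Finset.mem_sym_iff.2 fun i hi =>
      Finset.mem_Icc.2 ⟨n.parts_pos hi, ?_⟩, n.parts_sum⟩
    exact (n.le_of_mem_parts hi).trans hk
  · intro n _ n' _ h
    exact Nat.Partition.ext (congrArg Subtype.val h)
  · intro s hs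
    rw [Finset.mem_filter, Finset.mem_sym_iff] at hs
    refine ⟨⟨s.val, fun {i} hi => (Finset.mem_Icc.1 (hs.1 i hi)).1, hs.2⟩, ?_, rfl⟩
    simp
  · intro n hn
    rfl

lemma coeff_tauTail_pow_of_lt {k p : ℕ} (h : k < p) : PowerSeries.coeff k (tauTail ^ p) = 0 := by
  have h₁ : (PowerSeries.X : ℝ⟦X⟧) ∣ tauTail := by
    rw [PowerSeries.X_dvd_iff]
    simp [tauTail, ← PowerSeries.coeff_zero_eq_constantCoeff_apply]
  exact PowerSeries.X_pow_dvd_iff.1 (pow_dvd_pow_of_dvd h₁ p) k h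

lemma coefZ_eq (p r : ℕ) : coefZ p r =
    (p.factorial : ℝ)⁻¹ * PowerSeries.coeff r (PowerSeries.mk coefA * tauTail ^ p) := by
  rw [mul_comm (PowerSeries.mk coefA), PowerSeries.coeff_mul,
    Finset.Nat.sum_antidiagonal_eq_sum_range_succ_mk, coefZ, Finset.mul_sum]
  have hsub : Finset.Icc p r ⊆ Finset.range r.succ := by
    intro k hk
    rw [Finset.mem_Icc] at hk
    simp only [Finset.mem_range]
    omega
  rw [← Finset.sum_subset hsub]
  · refine Finset.sum_congr rfl fun k hk => ?_
    rw [sum_partition_tau (Finset.mem_Icc.1 hk).2, PowerSeries.coeff_mk]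
    ring
  · intro k hk hk'
    simp only [Finset.mem_range, Finset.mem_Icc] at hk hk'
    rw [coeff_tauTail_pow_of_lt (by omega)]
    ring

theorem coeff_secTan_eq_sum (n r : ℕ) : PowerSeries.coeff (n + 2 * r) (secTan n) =
    coefA r + ∑ p ∈ Finset.Icc 1 r, coefZ p r * (n.descFactorial p : ℝ) := by
  -- The isolated term `A_r` is the `p = 0` term of the binomial expansion.
  have h0 : coefZ 0 r = coefA r := by simp [coefZ_eq]
  have hdesc : ∀ p, coefZ p r * (n.descFactorial p : ℝ) =
      PowerSeries.coeff r (PowerSeries.mk coefA * (tauTail ^ p * (n.choose p : ℝ⟦X⟧))) := by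
    intro p
    rw [coefZ_eq, Nat.descFactorial_eq_factorial_mul_choose, ← mul_assoc (PowerSeries.mk coefA),
      ← map_natCast (PowerSeries.C (R := ℝ)), PowerSeries.coeff_mul_C]
    push_cast
    field_simp
  -- The binomial theorem sums up to `n`, the target up to `r`; the extra terms vanish because
  -- `z_{p,r} = 0` for `p > r` and the falling factorial is zero for `p > n`.
  have hrange : ∑ p ∈ Finset.range (r + 1), coefZ p r * (n.descFactorial p : ℝ) =
      ∑ p ∈ Finset.range (n + 1), coefZ p r * (n.descFactorial p : ℝ) := by
    have h₁ : ∀ m, r ≤ m → ∑ p ∈ Finset.range (r + 1), coefZ p r * (n.descFactorial p : ℝ) =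
        ∑ p ∈ Finset.range (m + 1), coefZ p r * (n.descFactorial p : ℝ) := by
      intro m hm
      refine Finset.sum_subset (Finset.range_mono (by omega)) fun p _ hp => ?_
      have : Finset.Icc p r = ∅ := Finset.Icc_eq_empty (by simp at hp; omega)
      simp [coefZ, this]
    have h₂ : ∀ m, n ≤ m → ∑ p ∈ Finset.range (n + 1), coefZ p r * (n.descFactorial p : ℝ) =
        ∑ p ∈ Finset.range (m + 1), coefZ p r * (n.descFactorial p : ℝ) := by
      intro m hm
      refine Finset.sum_subset (Finset.range_mono (by omega)) fun p _ hp => ?_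
      rw [Nat.descFactorial_eq_zero_iff_lt.2 (by simp at hp; omega)]
      simp
    rw [h₁ _ (le_max_left r n), h₂ _ (le_max_right r n)]
  rw [coeff_secTan, mk_tau, add_pow]
  simp only [one_pow, mul_one, Finset.mul_sum, map_sum, ← hdesc]
  rw [← hrange, Finset.sum_range_succ', h0, Nat.descFactorial_zero, Nat.cast_one, mul_one, add_comm,
    Finset.range_eq_Ico, Finset.sum_Ico_add' (fun p => coefZ p r * (n.descFactorial p : ℝ)) 0 r 1]
  rfl

/-! ### Powers of linear forms span the polynomials -/

/-- The linear form `∑ a_i L_i`. -/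
def lin (a : Fin 3 → ℝ) : N := ∑ i, a i • MvPolynomial.X i

lemma lin_add_smul_X (a : Fin 3 → ℝ) (t : ℝ) (i : Fin 3) :
    lin (a + t • Pi.single i 1) = lin a + t • MvPolynomial.X i := by
  simp only [lin, Pi.add_apply, Pi.smul_apply, add_smul, Finset.sum_add_distrib, smul_eq_mul]
  congr 1
  rw [Finset.sum_eq_single i] <;> simp +contextual

/-- A submodule containing all the powers `(u + t v)^(k+1)` contains `u^k v`. -/
lemma pow_mul_mem_of_forall_add_smul_pow_mem {A : Type*} [CommRing A] [Algebra ℝ A]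
    (W : Submodule ℝ A) (u v : A) (k : ℕ) (h : ∀ t : ℝ, (u + t • v) ^ (k + 1) ∈ W) :
    u ^ k * v ∈ W := by
  -- Linear functionals on the quotient by `W` turn the hypothesis into the vanishing of a real
  -- polynomial in `t`; its coefficient of `t` is `k + 1` times the value on `u^k v`.
  rw [← Submodule.Quotient.mk_eq_zero, ← Module.forall_dual_apply_eq_zero_iff ℝ]
  intro φ
  let c : ℕ → ℝ := fun j =>
    φ (Submodule.Quotient.mk (((k + 1).choose j : ℝ) • (v ^ j * u ^ (k + 1 - j))))
  have hP : ∑ j ∈ Finset.range (k + 2), Polynomial.monomial j (c j) = 0 := by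
    apply Polynomial.funext
    intro t
    have h₁ : φ (Submodule.Quotient.mk ((u + t • v) ^ (k + 1))) = 0 := by
      rw [(Submodule.Quotient.mk_eq_zero W).2 (h t), map_zero]
    have h₂ : (u + t • v) ^ (k + 1) = ∑ j ∈ Finset.range (k + 2),
        t ^ j • ((k + 1).choose j : ℝ) • (v ^ j * u ^ (k + 1 - j)) := by
      rw [add_comm, add_pow]
      refine Finset.sum_congr rfl fun j _ => ?_
      rw [smul_pow, Nat.cast_smul_eq_nsmul, nsmul_eq_mul, smul_mul_assoc, smul_mul_assoc]
      congr 1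
      ring
    rw [h₂, ← Submodule.mkQ_apply, map_sum, map_sum] at h₁
    simp only [map_smul, Submodule.mkQ_apply, smul_eq_mul] at h₁
    simp only [Polynomial.eval_finsetSum, Polynomial.eval_monomial, Polynomial.eval_zero, c]
    rw [← h₁]
    refine Finset.sum_congr rfl fun j _ => ?_
    rw [← Submodule.mkQ_apply, ← Submodule.mkQ_apply, map_smul, map_smul, smul_eq_mul]
    ring
  have h1 := congrArg (fun P => Polynomial.coeff P 1) hP
  simp only [Polynomial.finsetSum_coeff, Polynomial.coeff_monomial, Polynomial.coeff_zero] at h1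
  rw [Finset.sum_ite_eq' _ 1, if_pos (by simp)] at h1
  simp only [c, Nat.choose_one_right, pow_one, Nat.add_sub_cancel] at h1
  rw [← Submodule.mkQ_apply, map_smul, map_smul, smul_eq_mul, Submodule.mkQ_apply] at h1
  rw [mul_comm]
  exact (mul_eq_zero.1 h1).resolve_left (by positivity)

/-- The span contains `1` and, by polarization along `l + t X_i`, is stable under multiplication by
each `X_i`. -/
lemma span_lin_pow :
    Submodule.span ℝ (Set.range fun ak : (Fin 3 → ℝ) × ℕ => lin ak.1 ^ ak.2) = ⊤ := by
  set W := Submodule.span ℝ (Set.range fun ak : (Fin 3 → ℝ) × ℕ => lin ak.1 ^ ak.2) with hW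
  have hmem : ∀ a k, lin a ^ k ∈ W := fun a k => Submodule.subset_span ⟨(a, k), rfl⟩
  have hX : ∀ i, ∀ F ∈ W, F * MvPolynomial.X i ∈ W := by
    intro i F hF
    induction hF using Submodule.span_induction with
    | mem F hF =>
      obtain ⟨⟨a, k⟩, rfl⟩ := hF
      refine pow_mul_mem_of_forall_add_smul_pow_mem W _ _ _ fun t => ?_
      rw [← lin_add_smul_X]
      exact hmem _ _
    | zero => simp
    | add F G _ _ hF hG => rw [add_mul]; exact add_mem hF hG
    | smul c F _ hF => rw [smul_mul_assoc]; exact W.smul_mem c hF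
  rw [eq_top_iff]
  intro F _
  induction F using MvPolynomial.induction_on with
  | C c =>
    rw [MvPolynomial.C_eq_smul_one]
    exact W.smul_mem c (by simpa using hmem 0 0)
  | add F G hF hG => exact add_mem (hF trivial) (hG trivial)
  | mul_X F i hF => exact hX i F (hF trivial)

/-! ### Derivatives of powers of a linear form -/

/-- The squared length of the covector `a`. -/
def normSq (a : Fin 3 → ℝ) : ℝ := ∑ i, a i ^ 2

lemma sqrt_normSq_sq (a : Fin 3 → ℝ) : Real.sqrt (normSq a) ^ 2 = normSq a :=
  Real.sq_sqrt (Finset.sum_nonneg fun _ _ => sq_nonneg _)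

lemma pderiv_lin (j : Fin 3) (a : Fin 3 → ℝ) :
    MvPolynomial.pderiv j (lin a) = MvPolynomial.C (a j) := by
  simp only [lin, map_sum, Derivation.map_smul, MvPolynomial.pderiv_X]
  rw [Finset.sum_eq_single j]
  · simp [MvPolynomial.C_eq_smul_one]
  · intro i _ hi
    simp [hi]
  · simp

lemma pderiv_lin_pow_succ (j : Fin 3) (a : Fin 3 → ℝ) (n : ℕ) :
    MvPolynomial.pderiv j (lin a ^ (n + 1)) = ((n + 1 : ℝ) * a j) • lin a ^ n := by
  rw [Derivation.leibniz_pow, pderiv_lin, ← MvPolynomial.C_mul', smul_eq_mul, nsmul_eq_mul]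
  simp only [map_mul, map_add, map_natCast, map_one, Nat.add_sub_cancel]
  push_cast
  ring

lemma X_mul_lin_sum (a : Fin 3 → ℝ) : ∑ j, a j • (MvPolynomial.X j : N) = lin a := rfl

lemma sum_smul_rot_lin_pow (a : Fin 3 → ℝ) (n : ℕ) : ∑ i, a i • rot i (lin a ^ n) = 0 := by
  cases n with
  | zero => simp [rot]
  | succ n =>
    simp only [rot, pderiv_lin_pow_succ, Fin.sum_univ_three, mul_smul_comm, smul_sub, smul_smul]
    simp only [Fin.isValue, zero_add, show (1 : Fin 3) + 1 = 2 from rfl,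
      show (1 : Fin 3) + 2 = 0 from rfl, show (2 : Fin 3) + 1 = 0 from rfl,
      show (2 : Fin 3) + 2 = 1 from rfl]
    module

lemma sum_smul_cross_one (a : Fin 3 → ℝ) : ∑ i, a i • cross i 1 = 0 := by
  simp [cross]

/-- The first-order part of `cross` gives `2(n+1)` and the second-order part `(n+1)n`, the latter
because `∑ a_j L_j` restores the linear form. -/
lemma sum_smul_cross_lin_pow_succ (a : Fin 3 → ℝ) (n : ℕ) :
    ∑ i, a i • cross i (lin a ^ (n + 1)) = ((n + 1 : ℝ) * (n + 2) * normSq a) • lin a ^ n := by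
  have h : ∀ i, cross i (lin a ^ (n + 1)) = ((n + 1 : ℝ) * (n + 2) * a i) • lin a ^ n := by
    intro i
    have hj : ∀ j, (MvPolynomial.X j : N) *
        MvPolynomial.pderiv i (MvPolynomial.pderiv j (lin a ^ (n + 1))) =
        (n + 1 : ℝ) • (a j • (MvPolynomial.X j : N) * MvPolynomial.pderiv i (lin a ^ n)) := by
      intro j
      rw [pderiv_lin_pow_succ, Derivation.map_smul, mul_smul_comm, smul_mul_assoc, smul_smul]
    have hl : lin a * MvPolynomial.pderiv i (lin a ^ n) = ((n : ℝ) * a i) • lin a ^ n := by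
      cases n with
      | zero => simp
      | succ n =>
        rw [pderiv_lin_pow_succ, mul_smul_comm, ← pow_succ']
        push_cast
        rfl
    rw [cross]
    simp only [hj]
    rw [← Finset.smul_sum, ← Finset.sum_mul, X_mul_lin_sum, hl, pderiv_lin_pow_succ, two_mul]
    module
  simp only [h, smul_smul, normSq, Finset.mul_sum, Finset.sum_smul]
  refine Finset.sum_congr rfl fun i _ => ?_
  congr 1
  ring

/-! ### Star powers of a linear form -/

lemma starC_lin (r : ℕ) (a : Fin 3 → ℝ) (F : N) :
    starC r (lin a) F = ∑ i, a i • starC r (MvPolynomial.X i) F := by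
  simp [lin, LinearMap.sum_apply]

lemma starC_zero_lin (a : Fin 3 → ℝ) (F : N) : starC 0 (lin a) F = lin a * F := by
  rw [starC_lin]
  simp only [starC_zero_X, lin, Finset.sum_mul, smul_mul_assoc]

lemma starC_one_lin_pow (a : Fin 3 → ℝ) (n : ℕ) : starC 1 (lin a) (lin a ^ n) = 0 := by
  rw [starC_lin]
  simp only [starC_one_X, sum_smul_rot_lin_pow]

lemma starC_two_lin_one (a : Fin 3 → ℝ) : starC 2 (lin a) 1 = 0 := by
  rw [starC_lin]
  simp only [starC_two_X, sum_smul_cross_one]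

lemma starC_two_lin_pow_succ (a : Fin 3 → ℝ) (n : ℕ) : starC 2 (lin a) (lin a ^ (n + 1)) =
    ((n + 1 : ℝ) * (n + 2) * normSq a) • lin a ^ n := by
  rw [starC_lin]
  simp only [starC_two_X, sum_smul_cross_lin_pow_succ]

lemma coeff_zero_starProd_lin (a : Fin 3 → ℝ) (H : N⟦X⟧) :
    PowerSeries.coeff 0 (starProd (PowerSeries.C (lin a)) H) =
      lin a * PowerSeries.coeff 0 H := by
  simp [coeff_starProd_C, starC_zero_lin]

lemma coeff_one_starProd_lin (a : Fin 3 → ℝ) (H : N⟦X⟧) :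
    PowerSeries.coeff 1 (starProd (PowerSeries.C (lin a)) H) =
      lin a * PowerSeries.coeff 1 H + starC 1 (lin a) (PowerSeries.coeff 0 H) := by
  simp [coeff_starProd_C, Finset.Nat.antidiagonal_succ, starC_zero_lin]

lemma coeff_add_two_starProd_lin (m : ℕ) (a : Fin 3 → ℝ) (H : N⟦X⟧) :
    PowerSeries.coeff (m + 2) (starProd (PowerSeries.C (lin a)) H) =
      lin a * PowerSeries.coeff (m + 2) H + starC 1 (lin a) (PowerSeries.coeff (m + 1) H) +
        starC 2 (lin a) (PowerSeries.coeff m H) := by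
  have h : ∀ r F, starC (r + 3) (lin a) F = 0 := fun r F => by
    simp [starC_lin, starC_add_three_X]
  rw [coeff_starProd_C, Finset.Nat.sum_antidiagonal_eq_sum_range_succ_mk]
  simp only
  cases m with
  | zero => simp [Finset.sum_range_succ, starC_zero_lin]
  | succ m =>
    rw [Finset.sum_range_succ', Finset.sum_range_succ', Finset.sum_range_succ',
      Finset.sum_eq_zero fun r _ => by rw [show r + 1 + 1 + 1 = r + 3 by ring, h]]
    simp only [zero_add, Nat.sub_zero, starC_zero_lin]
    simp only [show m + 1 + 2 - (1 + 1) = m + 1 by omega, show m + 1 + 2 - 1 = m + 1 + 1 by omega]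
    abel

/-- The coefficient `(n + m)! / n! [u^{n + m}] (sec² u tanⁿ u)`. -/
def powCoeff (n m : ℕ) : ℝ :=
  (n + m).factorial / n.factorial * PowerSeries.coeff (n + m) (secTan n)

lemma powCoeff_zero_right (n : ℕ) : powCoeff n 0 = 1 := by
  have h : coefA 0 = 1 := by
    simp [coefA, gam, eulerNumber, PowerSeries.cos]
  have := coeff_secTan_eq_sum n 0
  simp only [mul_zero, add_zero, zero_lt_one, Finset.Icc_eq_empty_of_lt, Finset.sum_empty, h] at this
  rw [powCoeff, add_zero, this, mul_one, div_self (by positivity)]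

lemma powCoeff_of_odd (n : ℕ) {m : ℕ} (hm : ¬ Even m) : powCoeff n m = 0 := by
  rw [powCoeff, coeff_secTan_of_odd n hm, mul_zero]

/-- Boundary case of the recurrence: a constant term of `l ∗ H` can only come from contracting `l`
with the linear term of `H`. -/
lemma powCoeff_zero_left (m : ℕ) : powCoeff 0 (m + 2) = 2 * powCoeff 1 m := by
  have h := coeff_secTan_zero (m + 1)
  simp only [powCoeff, zero_add, Nat.factorial_zero, Nat.factorial_one, Nat.cast_one, div_one]
  rw [show m + 2 = m + 1 + 1 by ring, Nat.factorial_succ (m + 1), add_comm 1 m]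
  push_cast at h ⊢
  linear_combination ((m + 1).factorial : ℝ) * h

lemma powCoeff_succ (n m : ℕ) : powCoeff (n + 1) (m + 2) =
    powCoeff n (m + 2) + (n + 2) * (n + 3) * powCoeff (n + 2) m := by
  have h := coeff_secTan_succ n (n + m + 2)
  simp only [powCoeff]
  rw [show n + 1 + (m + 2) = n + m + 2 + 1 by ring, show n + (m + 2) = n + m + 2 by ring,
    show n + 2 + m = n + m + 2 by ring, Nat.factorial_succ (n + m + 2), Nat.factorial_succ (n + 1),
    Nat.factorial_succ n]
  have hn : (n.factorial : ℝ) ≠ 0 := by positivity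
  have hn1 : (n + 1 : ℝ) ≠ 0 := by positivity
  have hn2 : (n + 1 + 1 : ℝ) ≠ 0 := by positivity
  push_cast at h ⊢
  field_simp
  linear_combination ((n : ℝ) + 2) * h

/-- The coefficients of the star powers of a linear form. -/
lemma coeff_leftStar_lin_pow (a : Fin 3 → ℝ) (k : ℕ) : ∀ m,
    (k < m → PowerSeries.coeff m ((leftStar (lin a) ^ k) 1) = 0) ∧
    ∀ n, n + m = k → PowerSeries.coeff m ((leftStar (lin a) ^ k) 1) =
      (powCoeff n m * Real.sqrt (normSq a) ^ m) • lin a ^ n := by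
  -- Powers of `|a|` rather than `|a|²` let odd and even `m` share one formula; for odd `m` the
  -- coefficient is zero anyway.
  have hsq := sqrt_normSq_sq a
  induction k with
  | zero =>
    intro m
    refine ⟨fun hm => ?_, fun n hn => ?_⟩
    · simp [PowerSeries.coeff_one, hm.ne']
    · obtain ⟨rfl, rfl⟩ : n = 0 ∧ m = 0 := by omega
      simp [powCoeff_zero_right]
  | succ k ih =>
    have hstep : (leftStar (lin a) ^ (k + 1)) 1 =
        starProd (PowerSeries.C (lin a)) ((leftStar (lin a) ^ k) 1) := by
      rw [pow_succ']
      rfl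
    rw [hstep]
    generalize (leftStar (lin a) ^ k) 1 = H at ih
    have h1 : PowerSeries.coeff 1 H = 0 := by
      rcases Nat.eq_zero_or_pos k with rfl | hk
      · exact (ih 1).1 one_pos
      · rw [(ih 1).2 (k - 1) (by omega), powCoeff_of_odd _ (by decide)]
        simp
    have hrot : ∀ m ≤ k, starC 1 (lin a) (PowerSeries.coeff m H) = 0 := by
      intro m hm
      rw [(ih m).2 (k - m) (by omega), map_smul, starC_one_lin_pow, smul_zero]
    intro m
    match m with
    | 0 =>
      refine ⟨fun h => absurd h (by omega), fun n hn => ?_⟩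
      obtain rfl : n = k + 1 := by omega
      rw [coeff_zero_starProd_lin, (ih 0).2 k rfl, powCoeff_zero_right, powCoeff_zero_right,
        mul_smul_comm, ← pow_succ']
    | 1 =>
      refine ⟨fun h => absurd h (by omega), fun n hn => ?_⟩
      rw [coeff_one_starProd_lin, h1, hrot 0 (by omega), powCoeff_of_odd _ (by decide)]
      simp
    | m + 2 =>
      rw [coeff_add_two_starProd_lin]
      refine ⟨fun h => ?_, fun n hn => ?_⟩
      · rw [(ih (m + 2)).1 (by omega), (ih (m + 1)).1 (by omega)]
        rcases Nat.lt_or_ge k m with hk | hk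
        · rw [(ih m).1 hk]
          simp
        -- Here `k = m`: the coefficient of `H` is a constant, which `C₂(l, ·)` kills.
        · rw [(ih m).2 0 (by omega), pow_zero, map_smul, starC_two_lin_one]
          simp
      · rw [hrot (m + 1) (by omega), add_zero]
        cases n with
        | zero =>
          rw [(ih (m + 2)).1 (by omega), (ih m).2 1 (by omega), map_smul,
            starC_two_lin_pow_succ a 0, powCoeff_zero_left, mul_zero, zero_add, smul_smul, pow_add,
            hsq]
          congr 1
          push_cast
          ring
        | succ n =>
          rw [(ih (m + 2)).2 n (by omega), (ih m).2 (n + 2) (by omega), map_smul,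
            starC_two_lin_pow_succ a (n + 1), powCoeff_succ, mul_smul_comm, ← pow_succ', smul_smul,
            ← add_smul, pow_add, hsq]
          congr 1
          push_cast
          ring

/-! ### The operators `η_r` on powers of a linear form -/

lemma fallingOp_succ {A : Type*} [CommRing A] [Algebra ℝ A] (D : Module.End ℝ A) (p : ℕ) :
    fallingOp D (p + 1) = fallingOp D p * (D - (p : ℝ) • 1) := by
  simp [fallingOp, List.range_succ]

lemma fallingOp_eigenvector {A : Type*} [CommRing A] [Algebra ℝ A] {D : Module.End ℝ A} {f : A}
    {n : ℕ} (h : D f = (n : ℝ) • f) (p : ℕ) :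
    fallingOp D p f = (n.descFactorial p : ℝ) • f := by
  induction p with
  | zero => simp [fallingOp]
  | succ p ih =>
    have h₁ : (D - (p : ℝ) • 1) f = ((n : ℝ) - p) • f := by
      simp [h, sub_smul]
    rw [fallingOp_succ, Module.End.mul_apply, h₁, map_smul, ih, smul_smul, Nat.descFactorial_succ]
    rcases Nat.lt_or_ge n p with hp | hp
    · simp [Nat.descFactorial_eq_zero_iff_lt.2 hp]
    · push_cast [Nat.cast_sub hp]
      rfl

lemma eulerOp_lin_pow (a : Fin 3 → ℝ) (n : ℕ) :
    eulerOp MvPolynomial.X polyD (lin a ^ n) = (n : ℝ) • lin a ^ n := by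
  simp only [eulerOp, LinearMap.sum_apply, Module.End.mul_apply, LinearMap.mulLeft_apply]
  change ∑ k, MvPolynomial.X k * MvPolynomial.pderiv k (lin a ^ n) = _
  cases n with
  | zero => simp
  | succ n =>
    have h : ∀ k, (MvPolynomial.X k : N) * MvPolynomial.pderiv k (lin a ^ (n + 1)) =
        (n + 1 : ℝ) • ((a k • (MvPolynomial.X k : N)) * lin a ^ n) := by
      intro k
      rw [pderiv_lin_pow_succ, mul_smul_comm, smul_mul_assoc, smul_smul]
    simp only [h]
    rw [← Finset.smul_sum, ← Finset.sum_mul, X_mul_lin_sum, ← pow_succ']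
    push_cast
    rfl

lemma laplacian_lin_pow (a : Fin 3 → ℝ) (n : ℕ) : laplacian polyD (lin a ^ n) =
    ((n.descFactorial 2 : ℝ) * normSq a) • lin a ^ (n - 2) := by
  simp only [laplacian, LinearMap.sum_apply, sq, Module.End.mul_apply]
  change ∑ k, MvPolynomial.pderiv k (MvPolynomial.pderiv k (lin a ^ n)) = _
  match n with
  | 0 => simp
  | 1 => simp [pderiv_lin]
  | n + 2 =>
    simp only [pderiv_lin_pow_succ, Derivation.map_smul, smul_smul, ← Finset.sum_smul]
    congr 1
    rw [normSq, Finset.mul_sum]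
    refine Finset.sum_congr rfl fun k _ => ?_
    simp only [Nat.descFactorial_succ, Nat.descFactorial_zero]
    rw [show n + 2 - 1 = n + 1 by omega]
    push_cast
    ring

lemma laplacian_pow_lin_pow (a : Fin 3 → ℝ) (k r : ℕ) : (laplacian polyD ^ r) (lin a ^ k) =
    ((k.descFactorial (2 * r) : ℝ) * normSq a ^ r) • lin a ^ (k - 2 * r) := by
  induction r with
  | zero => simp
  | succ r ih =>
    rw [pow_succ', Module.End.mul_apply, ih, map_smul, laplacian_lin_pow, smul_smul, Nat.sub_sub]
    congr 1
    simp only [mul_add, mul_one, Nat.descFactorial_succ, Nat.descFactorial_zero, Nat.sub_zero]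
    push_cast
    rw [Nat.sub_sub]
    ring

/-- `Δ^r` produces `(n+2r)!/n!·|a|^(2r)·l^n`, an eigenvector of the Euler operator with eigenvalue
`n`. The polynomial in `D` then takes the value given by `coeff_secTan_eq_sum`. -/
lemma eta_lin_pow (a : Fin 3 → ℝ) (n r : ℕ) : eta r (lin a ^ (n + 2 * r)) =
    (powCoeff n (2 * r) * normSq a ^ r) • lin a ^ n := by
  have h : ((n + 2 * r).descFactorial (2 * r) : ℝ) =
      (n + 2 * r).factorial / n.factorial := by
    have := Nat.factorial_mul_descFactorial (show 2 * r ≤ n + 2 * r by omega)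
    rw [Nat.add_sub_cancel] at this
    rw [eq_div_iff (by positivity), mul_comm]
    exact_mod_cast this
  rw [eta, etaOp, Module.End.mul_apply, laplacian_pow_lin_pow, Nat.add_sub_cancel, map_smul]
  simp only [LinearMap.add_apply, LinearMap.sum_apply, LinearMap.smul_apply, Module.End.one_apply,
    fallingOp_eigenvector (eulerOp_lin_pow a n), smul_smul, ← Finset.sum_smul, ← add_smul]
  rw [← coeff_secTan_eq_sum, h, powCoeff]
  congr 1
  ring

lemma eta_lin_pow_of_lt (a : Fin 3 → ℝ) {k r : ℕ} (h : k < 2 * r) : eta r (lin a ^ k) = 0 := by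
  rw [eta, etaOp, Module.End.mul_apply, laplacian_pow_lin_pow,
    Nat.descFactorial_eq_zero_iff_lt.2 h]
  simp

lemma leftStar_lin_pow (a : Fin 3 → ℝ) (k : ℕ) : (leftStar (lin a) ^ k) 1 =
    PowerSeries.C (lin a ^ k) + evenSeries fun r => eta r (lin a ^ k) := by
  ext1 m
  rw [map_add, evenSeries, PowerSeries.coeff_mk, PowerSeries.coeff_C]
  rcases Nat.eq_zero_or_pos m with rfl | hm
  · rw [(coeff_leftStar_lin_pow a k 0).2 k rfl, powCoeff_zero_right]
    simp
  rw [if_neg hm.ne', zero_add]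
  by_cases he : Even m
  · rw [if_pos ⟨hm.ne', he⟩]
    obtain ⟨r, hr⟩ := he
    obtain rfl : m = 2 * r := by omega
    rw [Nat.mul_div_cancel_left r two_pos]
    rcases Nat.lt_or_ge k (2 * r) with hk | hk
    · rw [(coeff_leftStar_lin_pow a k _).1 hk, eta_lin_pow_of_lt a hk]
    · obtain ⟨n, rfl⟩ := Nat.exists_eq_add_of_le' hk
      rw [(coeff_leftStar_lin_pow a _ _).2 n rfl, eta_lin_pow, pow_mul,
        sqrt_normSq_sq]
  · rw [if_neg fun h => he h.2]
    rcases Nat.lt_or_ge k m with hk | hk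
    · exact (coeff_leftStar_lin_pow a k _).1 hk
    · rw [(coeff_leftStar_lin_pow a k m).2 (k - m) (by omega), powCoeff_of_odd _ he]
      simp

/-! ### The sun product of polynomials -/

/-- The restriction of `α` to `N`, as an algebra homomorphism. -/
def alphaHom : N →ₐ[ℝ] S :=
  MvPolynomial.aeval fun i => SymmetricAlgebra.ι ℝ N (MvPolynomial.X i)

lemma sun_C (F G : N) : sun (PowerSeries.C F) (PowerSeries.C G) = T (alphaHom (F * G)) := by
  simp [sun, alpha, alphaHom]

lemma alphaHom_lin (a : Fin 3 → ℝ) : alphaHom (lin a) = SymmetricAlgebra.ι ℝ N (lin a) := by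
  simp [alphaHom, lin]

/-- All `k!` orderings of equal factors coincide, so symmetrization does nothing. -/
lemma T_ι_pow (F : N) (k : ℕ) :
    T (SymmetricAlgebra.ι ℝ N F ^ k) = (leftStar F ^ k) 1 := by
  have h := T_prod fun _ : Fin k => F
  have h₁ : iteratedStar (fun _ : Fin k => F) = (leftStar F ^ k) 1 := by
    rw [iteratedStar_eq, List.ofFn_const, List.prod_replicate]
  have h₂ : ∀ σ : Equiv.Perm (Fin k), (fun _ : Fin k => F) ∘ σ = fun _ => F := fun _ => rfl
  simp only [h₂, h₁, Finset.prod_const, Finset.card_univ, Fintype.card_fin, Finset.sum_const,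
    Fintype.card_perm] at h
  rw [h, ← Nat.cast_smul_eq_nsmul ℝ, smul_smul, inv_mul_cancel₀ (by positivity), one_smul]

lemma T_alphaHom (F : N) :
    T (alphaHom F) = PowerSeries.C F + evenSeries fun r => eta r F := by
  ext1 m
  -- For fixed `m` both sides are linear in `F`, so agreement on powers of linear forms suffices.
  let A : N →ₗ[ℝ] N := if m = 0 then LinearMap.id else if Even m then eta (m / 2) else 0
  have hA : ∀ F, PowerSeries.coeff m (PowerSeries.C F + evenSeries fun r => eta r F) = A F := by
    intro F
    simp only [map_add, evenSeries, PowerSeries.coeff_mk, PowerSeries.coeff_C, A]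
    by_cases h0 : m = 0 <;> by_cases he : Even m <;> simp [h0, he]
  have h : (PowerSeries.coeff (R := N) m).restrictScalars ℝ ∘ₗ T ∘ₗ alphaHom.toLinearMap = A := by
    refine LinearMap.ext_on_range span_lin_pow fun ak => ?_
    rw [← hA, ← leftStar_lin_pow, ← T_ι_pow, ← alphaHom_lin, ← map_pow]
    rfl
  rw [hA, ← h]
  rfl

theorem sun_eq (F G : N) : sun (PowerSeries.C F) (PowerSeries.C G) =
    PowerSeries.C (F * G) + evenSeries fun r => eta r (F * G) := by
  rw [sun_C, T_alphaHom]

/-! ### Partial derivatives of smooth functions -/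

lemma smoothD_mul (i : Fin 3) (F G : Smooth) :
    smoothD i (F * G) = F * smoothD i G + G * smoothD i F := by
  ext x
  change fderiv ℝ (F.1 * G.1) x _ = F.1 x * fderiv ℝ G.1 x _ + G.1 x * fderiv ℝ F.1 x _
  rw [fderiv_mul (differentiable_smooth F x) (differentiable_smooth G x)]
  simp

lemma smoothD_toSmooth_X (i j : Fin 3) : smoothD i (toSmooth (MvPolynomial.X j)) =
    toSmooth (MvPolynomial.pderiv i (MvPolynomial.X j)) := by
  ext x
  have h : (toSmooth (MvPolynomial.X j)).1 = fun x : Fin 3 → ℝ => x j := by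
    funext y
    rw [toSmooth_apply, MvPolynomial.eval_X]
  change fderiv ℝ (toSmooth (MvPolynomial.X j)).1 x (Pi.single i 1) = _
  have hf : fderiv ℝ (fun x : Fin 3 → ℝ => x j) x = ContinuousLinearMap.proj j :=
    (ContinuousLinearMap.proj (R := ℝ) (φ := fun _ : Fin 3 => ℝ) j).hasFDerivAt.fderiv
  rw [h, hf, toSmooth_apply, MvPolynomial.pderiv_X]
  by_cases hij : i = j
  · subst hij
    simp
  · simp [Ne.symm hij]

lemma smoothD_algebraMap (i : Fin 3) (c : ℝ) : smoothD i (algebraMap ℝ Smooth c) = 0 := by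
  ext x
  change fderiv ℝ (fun _ : Fin 3 → ℝ => c) x (Pi.single i 1) = 0
  simp

lemma smoothD_toSmooth (i : Fin 3) (F : N) :
    smoothD i (toSmooth F) = toSmooth (MvPolynomial.pderiv i F) := by
  induction F using MvPolynomial.induction_on with
  | C c =>
    rw [MvPolynomial.pderiv_C, map_zero, ← MvPolynomial.algebraMap_eq, AlgHom.commutes,
      smoothD_algebraMap]
  | add F G hF hG => rw [map_add, map_add, hF, hG, map_add, map_add]
  | mul_X F j hF =>
    rw [map_mul, smoothD_mul, hF, smoothD_toSmooth_X, Derivation.leibniz, map_add, smul_eq_mul,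
      smul_eq_mul, map_mul, map_mul]

lemma commute_smoothD (i j : Fin 3) : Commute (smoothD i) (smoothD j) := by
  refine LinearMap.ext fun F => ?_
  ext x
  have hF : ContDiff ℝ ∞ F.1 := contDiff_smooth F
  have hd : DifferentiableAt ℝ (fderiv ℝ F.1) x :=
    (hF.fderiv_right (m := ∞) (by simp)).differentiable (by simp) x
  have h : ∀ v w, fderiv ℝ (fun y => fderiv ℝ F.1 y v) x w = fderiv ℝ (fderiv ℝ F.1) x w v := by
    intro v w
    rw [fderiv_clm_apply hd (differentiableAt_const v)]
    simp
  change fderiv ℝ (fun y => fderiv ℝ F.1 y (Pi.single j 1)) x (Pi.single i 1) =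
    fderiv ℝ (fun y => fderiv ℝ F.1 y (Pi.single i 1)) x (Pi.single j 1)
  rw [h, h]
  exact (hF.contDiffAt.isSymmSndFDerivAt (by
    rw [minSmoothness_of_isRCLikeNormedField]
    exact WithTop.coe_le_coe.2 le_top)) _ _

lemma smoothD_multiD (i : Fin 3) (a : Fin 3 → ℕ) :
    smoothD i * multiD a = multiD (a + Pi.single i 1) := by
  have h01 : ∀ k, smoothD 1 * smoothD 0 ^ k = smoothD 0 ^ k * smoothD 1 := fun k =>
    ((commute_smoothD 1 0).pow_right k).eq
  have h02 : ∀ k, smoothD 2 * smoothD 0 ^ k = smoothD 0 ^ k * smoothD 2 := fun k =>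
    ((commute_smoothD 2 0).pow_right k).eq
  have h12 : ∀ k, smoothD 2 * smoothD 1 ^ k = smoothD 1 ^ k * smoothD 2 := fun k =>
    ((commute_smoothD 2 1).pow_right k).eq
  fin_cases i
  · simp [multiD, pow_succ', mul_assoc]
  · simp only [multiD, Fin.mk_one, Pi.add_apply]
    simp only [← mul_assoc, h01]
    simp [pow_succ', mul_assoc]
  · simp only [multiD, Fin.reduceFinMk, Pi.add_apply]
    simp only [← mul_assoc, h02]
    simp only [mul_assoc (smoothD 0 ^ a 0), h12]
    simp [pow_succ', mul_assoc]

/-! ### Bidifferential operators -/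

/-- The operator `(F, G) ↦ ∂^a F ∂^b G`. -/
def bidiffMonomial (ab : (Fin 3 → ℕ) × (Fin 3 → ℕ)) : Smooth → Smooth → Smooth :=
  fun F G => multiD ab.1 F * multiD ab.2 G

/-- The `C^∞(ℝ³)`-module of bidifferential operators. -/
def bidiffModule : Submodule Smooth (Smooth → Smooth → Smooth) :=
  Submodule.span Smooth (Set.range bidiffMonomial)

/-- Membership in a span over the smooth functions makes closure under sums, smooth multiples and
derivatives accessible by span induction. -/
lemma isBidifferential_iff (B : Smooth → Smooth → Smooth) :
    IsBidifferential B ↔ B ∈ bidiffModule := by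
  constructor
  · rintro ⟨s, c, h⟩
    have hB : B = ∑ ab ∈ s, c ab • bidiffMonomial ab := by
      funext F G
      rw [h]
      simp [bidiffMonomial, mul_assoc]
    rw [hB]
    exact Submodule.sum_mem _ fun ab _ =>
      Submodule.smul_mem _ _ (Submodule.subset_span ⟨ab, rfl⟩)
  · intro h
    obtain ⟨c, rfl⟩ := Finsupp.mem_span_range_iff_exists_finsupp.1 h
    refine ⟨c.support, c, fun F G => ?_⟩
    simp [Finsupp.sum, bidiffMonomial, mul_assoc]

lemma mul_mem_bidiffModule : (fun F G => F * G : Smooth → Smooth → Smooth) ∈ bidiffModule := by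
  refine Submodule.subset_span ⟨(0, 0), ?_⟩
  funext F G
  simp [bidiffMonomial, multiD]

lemma smoothD_comp_mem_bidiffModule (i : Fin 3) {B : Smooth → Smooth → Smooth}
    (hB : B ∈ bidiffModule) : (fun F G => smoothD i (B F G)) ∈ bidiffModule := by
  induction hB using Submodule.span_induction with
  | mem B hB =>
    obtain ⟨ab, rfl⟩ := hB
    have h : (fun F G => smoothD i (bidiffMonomial ab F G)) =
        bidiffMonomial (ab.1, ab.2 + Pi.single i 1) +
          bidiffMonomial (ab.1 + Pi.single i 1, ab.2) := by
      funext F G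
      simp only [bidiffMonomial, Pi.add_apply, smoothD_mul, ← smoothD_multiD, Module.End.mul_apply]
      ring
    rw [h]
    exact add_mem (Submodule.subset_span ⟨_, rfl⟩) (Submodule.subset_span ⟨_, rfl⟩)
  | zero =>
    simp only [Pi.zero_apply, map_zero]
    exact zero_mem bidiffModule
  | add B B' _ _ hB hB' =>
    simp only [Pi.add_apply, map_add]
    exact add_mem hB hB'
  | smul c B hmem hB =>
    have h : (fun F G => smoothD i ((c • B) F G)) =
        c • (fun F G => smoothD i (B F G)) + smoothD i c • B := by
      funext F G
      simp only [Pi.smul_apply, Pi.add_apply, smul_eq_mul, smoothD_mul]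
      ring
    rw [h]
    exact add_mem (Submodule.smul_mem _ _ hB) (Submodule.smul_mem _ _ hmem)

/-- The linear operators on `C^∞(ℝ³)` whose composition with every bidifferential operator is
bidifferential. -/
def diffOps : Subalgebra ℝ (Module.End ℝ Smooth) where
  carrier := {P | ∀ B ∈ bidiffModule, (fun F G => P (B F G)) ∈ bidiffModule}
  mul_mem' {P Q} hP hQ B hB := hP _ (hQ B hB)
  add_mem' {P Q} hP hQ B hB := add_mem (hP B hB) (hQ B hB)
  algebraMap_mem' c B hB := by
    have h : (fun F G => (algebraMap ℝ (Module.End ℝ Smooth) c) (B F G)) =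
        algebraMap ℝ Smooth c • B := by
      funext F G
      simp [Algebra.smul_def]
    rw [h]
    exact Submodule.smul_mem _ _ hB

lemma etaSmooth_mem_diffOps (r : ℕ) : etaSmooth r ∈ diffOps := by
  have hd : ∀ i, smoothD i ∈ diffOps := fun i B hB => smoothD_comp_mem_bidiffModule i hB
  have hm : ∀ f : Smooth, LinearMap.mulLeft ℝ f ∈ diffOps := fun f B hB =>
    Submodule.smul_mem _ f hB
  have hE : eulerOp smoothCoord smoothD ∈ diffOps :=
    sum_mem fun k _ => mul_mem (hm _) (hd k)
  have hL : laplacian smoothD ∈ diffOps := sum_mem fun k _ => pow_mem (hd k) 2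
  refine mul_mem (add_mem (Subalgebra.smul_mem _ (one_mem _) _) (sum_mem fun p _ =>
    Subalgebra.smul_mem _ (list_prod_mem fun P hP => ?_) _)) (pow_mem hL r)
  obtain ⟨i, _, rfl⟩ := List.mem_map.1 hP
  have h : eulerOp smoothCoord smoothD - i • 1 = eulerOp smoothCoord smoothD + (-i) • 1 :=
    LinearMap.ext fun f => by simp [sub_eq_add_neg]
  rw [h]
  exact add_mem hE (Subalgebra.smul_mem _ (one_mem _) _)

/-- The value at a point, as an algebra homomorphism. -/
def evalAt (x : Fin 3 → ℝ) : Smooth →ₐ[ℝ] ℝ :=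
  (Pi.evalAlgHom ℝ (fun _ : Fin 3 → ℝ => ℝ) x).comp smoothSubalgebra.val

lemma evalAt_apply (x : Fin 3 → ℝ) (f : Smooth) : evalAt x f = f.1 x := rfl

/-- The coordinates centred at `x`. -/
def centred (x : Fin 3 → ℝ) (i : Fin 3) : N := MvPolynomial.X i - MvPolynomial.C (x i)

/-- The monomial `(L - x)^b`. -/
def centredMonomial (x : Fin 3 → ℝ) (b : Fin 3 → ℕ) : N :=
  centred x 0 ^ b 0 * (centred x 1 ^ b 1 * centred x 2 ^ b 2)

lemma evalAt_centred (x : Fin 3 → ℝ) (i : Fin 3) : evalAt x (toSmooth (centred x i)) = 0 := by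
  rw [evalAt_apply, toSmooth_apply]
  simp [centred]

lemma smoothD_centred_self (x : Fin 3 → ℝ) (i : Fin 3) :
    smoothD i (toSmooth (centred x i)) = 1 := by
  rw [smoothD_toSmooth]
  simp [centred]

lemma smoothD_pow_of_eq_zero {i : Fin 3} {g : Smooth} (hg : smoothD i g = 0) (n : ℕ) :
    smoothD i (g ^ n) = 0 := by
  induction n with
  | zero => simpa using smoothD_algebraMap i 1
  | succ n ih => rw [pow_succ, smoothD_mul, ih, hg, mul_zero, mul_zero, add_zero]

lemma smoothD_centred_of_ne (x : Fin 3 → ℝ) {i j : Fin 3} (h : j ≠ i) :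
    smoothD i (toSmooth (centred x j)) = 0 := by
  rw [smoothD_toSmooth]
  simp [centred, MvPolynomial.pderiv_X_of_ne h]

lemma smoothD_pow_apply_pow_mul {i : Fin 3} {y g : Smooth} (hy : smoothD i y = 1)
    (hg : smoothD i g = 0) (k m : ℕ) :
    (smoothD i ^ k) (g * y ^ m) = (m.descFactorial k : ℝ) • (g * y ^ (m - k)) := by
  have h1 : ∀ m : ℕ, smoothD i (y ^ m) = (m : ℝ) • y ^ (m - 1) := by
    intro m
    induction m with
    | zero => simpa using smoothD_algebraMap i 1
    | succ m ih =>
      rw [pow_succ, smoothD_mul, ih, hy, mul_one, mul_smul_comm, Nat.add_sub_cancel]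
      cases m with
      | zero => simp
      | succ m =>
        rw [Nat.add_sub_cancel, ← pow_succ']
        push_cast
        module
  induction k with
  | zero => simp
  | succ k ih =>
    rw [pow_succ', Module.End.mul_apply, ih, map_smul, smoothD_mul, hg, mul_zero, add_zero, h1,
      mul_smul_comm, smul_smul, Nat.descFactorial_succ, Nat.sub_sub]
    push_cast
    rw [mul_comm]

lemma descFactorial_mul_zero_pow (a b : ℕ) :
    (b.descFactorial a : ℝ) * 0 ^ (b - a) = if a = b then (b.factorial : ℝ) else 0 := by
  rcases lt_trichotomy a b with h | rfl | h
  · rw [zero_pow (by omega), mul_zero, if_neg h.ne]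
  · simp [Nat.descFactorial_self]
  · rw [Nat.descFactorial_eq_zero_iff_lt.2 h, if_neg h.ne']
    simp

/-- Up to factorials, the centred monomials are dual at `x` to the operators `∂^a`: in each variable
too few derivatives leave a factor vanishing at `x`, and too many give zero. -/
lemma evalAt_multiD_centredMonomial (x : Fin 3 → ℝ) (a b : Fin 3 → ℕ) :
    evalAt x (multiD a (toSmooth (centredMonomial x b))) =
      if a = b then ∏ i, ((b i).factorial : ℝ) else 0 := by
  set y := fun i => toSmooth (centred x i) with hy
  have hd : ∀ i, smoothD i (y i) = 1 := smoothD_centred_self x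
  have hp : ∀ {i j : Fin 3} (n : ℕ), j ≠ i → smoothD i (y j ^ n) = 0 := fun n h =>
    smoothD_pow_of_eq_zero (smoothD_centred_of_ne x h) n
  have hm : ∀ {i : Fin 3} {f g : Smooth}, smoothD i f = 0 → smoothD i g = 0 →
      smoothD i (f * g) = 0 := fun hf hg => by rw [smoothD_mul, hf, hg, mul_zero, mul_zero, add_zero]
  have hb : toSmooth (centredMonomial x b) = y 0 ^ b 0 * y 1 ^ b 1 * y 2 ^ b 2 := by
    simp only [centredMonomial, map_mul, map_pow, hy, mul_assoc]
  have h2 := smoothD_pow_apply_pow_mul (hd 2)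
    (hm (hp (j := 0) (b 0) (by decide)) (hp (j := 1) (b 1) (by decide))) (a 2) (b 2)
  have h1 := smoothD_pow_apply_pow_mul (hd 1)
    (hm (hp (j := 0) (b 0) (by decide)) (hp (j := 2) (b 2 - a 2) (by decide))) (a 1) (b 1)
  have h0 := smoothD_pow_apply_pow_mul (hd 0)
    (hm (hp (j := 1) (b 1 - a 1) (by decide)) (hp (j := 2) (b 2 - a 2) (by decide))) (a 0) (b 0)
  have hall : multiD a (toSmooth (centredMonomial x b)) =
      ((b 2).descFactorial (a 2) : ℝ) • ((b 1).descFactorial (a 1) : ℝ) •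
        ((b 0).descFactorial (a 0) : ℝ) •
        (y 1 ^ (b 1 - a 1) * y 2 ^ (b 2 - a 2) * y 0 ^ (b 0 - a 0)) := by
    rw [hb, multiD, Module.End.mul_apply, Module.End.mul_apply, h2, map_smul, mul_right_comm, h1,
      map_smul, map_smul,
      show y 0 ^ b 0 * y 2 ^ (b 2 - a 2) * y 1 ^ (b 1 - a 1) =
        y 1 ^ (b 1 - a 1) * y 2 ^ (b 2 - a 2) * y 0 ^ b 0 by ring, h0]
  have he : ∀ i, evalAt x (y i) = 0 := evalAt_centred x
  rw [hall]
  simp only [map_smul, map_mul, map_pow, he, smul_eq_mul]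
  have hab : a = b ↔ a 0 = b 0 ∧ a 1 = b 1 ∧ a 2 = b 2 := by
    simp [funext_iff, Fin.forall_fin_succ]
  have hmul : ((b 2).descFactorial (a 2) : ℝ) * ((b 1).descFactorial (a 1) *
      ((b 0).descFactorial (a 0) * ((0 : ℝ) ^ (b 1 - a 1) * 0 ^ (b 2 - a 2) * 0 ^ (b 0 - a 0)))) =
      ((b 0).descFactorial (a 0) * 0 ^ (b 0 - a 0)) * ((b 1).descFactorial (a 1) *
        0 ^ (b 1 - a 1)) * ((b 2).descFactorial (a 2) * 0 ^ (b 2 - a 2)) := by ring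
  rw [hmul, descFactorial_mul_zero_pow, descFactorial_mul_zero_pow, descFactorial_mul_zero_pow,
    Fin.prod_univ_three]
  by_cases h : a = b
  · subst h
    simp
  · rw [if_neg h]
    rw [hab, not_and_or, not_and_or] at h
    rcases h with h | h | h <;> rw [if_neg h] <;> simp

/-- A bidifferential operator that vanishes on polynomials is zero. -/
lemma eq_zero_of_mem_bidiffModule {B : Smooth → Smooth → Smooth} (hB : B ∈ bidiffModule)
    (h : ∀ F G : N, B (toSmooth F) (toSmooth G) = 0) : B = 0 := by
  obtain ⟨c, rfl⟩ := Finsupp.mem_span_range_iff_exists_finsupp.1 hB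
  have hc : ∀ ab, c ab = 0 := by
    rintro ⟨a, b⟩
    ext x
    -- The test polynomials depend on `x`; they isolate the single value `c (a, b)` at `x` with a
    -- nonzero factor.
    have h₁ := congrArg (evalAt x) (h (centredMonomial x a) (centredMonomial x b))
    simp only [Finsupp.sum, Finset.sum_apply, Pi.smul_apply, smul_eq_mul, bidiffMonomial, map_sum,
      map_mul, evalAt_multiD_centredMonomial, map_zero] at h₁
    rw [Finset.sum_eq_single (a, b)] at h₁
    · rw [if_pos rfl, if_pos rfl, mul_eq_zero, or_iff_left] at h₁
      · exact h₁
      · positivity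
    · rintro ⟨a', b'⟩ _ hne
      by_cases ha : a' = a
      · have hb : b' ≠ b := fun hb => hne (by rw [ha, hb])
        simp [hb]
      · simp [ha]
    · intro hab
      rw [Finsupp.notMem_support_iff.1 hab]
      simp
  have : c = 0 := Finsupp.ext hc
  simp [this]

/-! ### The extension of the sun product to smooth functions -/

/-- `η_r` is a noncommutative polynomial in the coordinates and the derivations, so it is carried
along by any algebra map respecting both. It is used to compare the polynomial and smooth versions.
-/
lemma etaOp_intertwine {A A' : Type*} [CommRing A] [Algebra ℝ A] [CommRing A'] [Algebra ℝ A']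
    (φ : A →ₐ[ℝ] A') {x : Fin 3 → A} {d : Fin 3 → Module.End ℝ A} {x' : Fin 3 → A'}
    {d' : Fin 3 → Module.End ℝ A'} (hx : ∀ i, φ (x i) = x' i)
    (hd : ∀ i f, φ (d i f) = d' i (φ f)) (r : ℕ) (f : A) :
    φ (etaOp x d r f) = etaOp x' d' r (φ f) := by
  have hE : ∀ f, φ (eulerOp x d f) = eulerOp x' d' (φ f) := by
    intro f
    simp [eulerOp, LinearMap.sum_apply, hx, hd]
  have hL : ∀ f, φ (laplacian d f) = laplacian d' (φ f) := by
    intro f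
    simp [laplacian, LinearMap.sum_apply, sq, hd]
  have hLr : ∀ r f, φ ((laplacian d ^ r) f) = (laplacian d' ^ r) (φ f) := by
    intro r
    induction r with
    | zero => simp
    | succ r ih =>
      intro f
      rw [pow_succ, pow_succ, Module.End.mul_apply, Module.End.mul_apply, ih, hL]
  have hF : ∀ p f, φ (fallingOp (eulerOp x d) p f) = fallingOp (eulerOp x' d') p (φ f) := by
    intro p
    induction p with
    | zero => simp [fallingOp]
    | succ p ih =>
      intro f
      rw [fallingOp_succ, fallingOp_succ, Module.End.mul_apply, Module.End.mul_apply, ih]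
      simp [hE]
  rw [etaOp, etaOp, Module.End.mul_apply, Module.End.mul_apply, ← hLr]
  simp [LinearMap.sum_apply, hF]

lemma toSmooth_eta (r : ℕ) (F : N) : toSmooth (eta r F) = etaSmooth r (toSmooth F) :=
  etaOp_intertwine toSmooth (fun i => by simp [toSmooth])
    (fun i f => (smoothD_toSmooth i f).symm) r F

/-- The sun product of smooth functions. -/
def sunSmooth (F G : Smooth) : Smooth⟦X⟧ :=
  PowerSeries.C (F * G) + evenSeries fun r => etaSmooth r (F * G)

lemma sunSmooth_isSmoothExtension : IsSmoothExtension sunSmooth := by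
  constructor
  · intro n
    rw [isBidifferential_iff]
    have h : (fun F G => PowerSeries.coeff n (sunSmooth F G)) = fun F G =>
        (if n = 0 then (1 : Module.End ℝ Smooth) else if Even n then etaSmooth (n / 2) else 0)
          (F * G) := by
      funext F G
      simp only [sunSmooth, map_add, evenSeries, PowerSeries.coeff_mk, PowerSeries.coeff_C]
      by_cases h0 : n = 0 <;> by_cases he : Even n <;> simp [h0, he]
    have hmem : (if n = 0 then (1 : Module.End ℝ Smooth) else
        if Even n then etaSmooth (n / 2) else 0) ∈ diffOps := by
      split_ifs
      · exact one_mem _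
      · exact etaSmooth_mem_diffOps _
      · exact zero_mem _
    rw [h]
    exact hmem _ mul_mem_bidiffModule
  · intro F G
    rw [sun_eq, sunSmooth]
    ext1 n
    simp only [map_add, evenSeries, PowerSeries.coeff_map, PowerSeries.coeff_mk,
      PowerSeries.coeff_C, ← map_mul, ← toSmooth_eta]
    change _ = toSmooth _ + toSmooth _
    split_ifs <;> simp

lemma eq_sunSmooth {B : Smooth → Smooth → Smooth⟦X⟧} (hB : IsSmoothExtension B) :
    B = sunSmooth := by
  funext F G
  ext1 n
  have h₁ := (isBidifferential_iff _).1 (hB.1 n)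
  have h₂ := (isBidifferential_iff _).1 (sunSmooth_isSmoothExtension.1 n)
  have h := eq_zero_of_mem_bidiffModule (sub_mem h₁ h₂) fun F G => by
    simp only [Pi.sub_apply]
    rw [hB.2, sunSmooth_isSmoothExtension.2, sub_self]
  exact sub_eq_zero.1 (congrFun (congrFun h F) G)

end

end SunProduct

theorem theorem4 :
    -- the star product on `ℝ³` is the one induced by the Moyal product on `ℝ⁶`
    (∀ F G : N, PowerSeries.map pullback.toRingHom (starProd (PowerSeries.C F) (PowerSeries.C G)) =
      moyal (pullback F) (pullback G)) ∧
    -- `L_i ∗ F = L_i F + ν ∑ ε_{ijk} L_k ∂_j F + ν² (2 ∂_i F + ∑ L_j ∂_i ∂_j F)`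
    (∀ (i : Fin 3) (F : N), starProd (PowerSeries.C (MvPolynomial.X i)) (PowerSeries.C F) =
      PowerSeries.C (MvPolynomial.X i * F) +
      PowerSeries.X * PowerSeries.C
        (∑ j, ∑ k, MvPolynomial.C (eps i j k) * MvPolynomial.X k * MvPolynomial.pderiv j F) +
      PowerSeries.X ^ 2 * PowerSeries.C
        (2 * MvPolynomial.pderiv i F +
          ∑ j, MvPolynomial.X j * MvPolynomial.pderiv i (MvPolynomial.pderiv j F))) ∧
    -- the form of the sun product on polynomials
    (∀ F G : N, sun (PowerSeries.C F) (PowerSeries.C G) =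
      PowerSeries.C (F * G) + evenSeries fun r => eta r (F * G)) ∧
    -- the unique extension to smooth functions, and its form
    (∃! B : Smooth → Smooth → PowerSeries Smooth, IsSmoothExtension B) ∧
    (∀ B : Smooth → Smooth → PowerSeries Smooth, IsSmoothExtension B →
      ∀ F G : Smooth, B F G =
        PowerSeries.C (F * G) + evenSeries fun r => etaSmooth r (F * G)) := by
  refine ⟨map_pullback_starProd, starProd_X, sun_eq,
    ⟨sunSmooth, sunSmooth_isSmoothExtension, fun B hB => eq_sunSmooth hB⟩, fun B hB F G => ?_⟩
  rw [eq_sunSmooth hB, sunSmooth]
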